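/- **Language.** Fix disjoint infinite sets of actor classes $C$, method names $m$ and variables $x$ (the latter totally ordered), and infinitely many, totally ordered, actor names $A$ for every class (written $A\in C$). In the stateless actor language, expressions are $E::=x\mid \mathtt{new}\,C$ and processes are $P::=0\mid \mathtt{let}\ x=E\ \mathtt{in}\ P\mid x!m(\tilde E).P\mid [E=E']P;P'\mid P+P'$, up to alpha-conversion; at run time actor names may also replace variables, and *values* are variables and actor names. A *program* is a main process (not using $\mathit{this}$) and finitely many definitions $C.m(\tilde x)=P_{C,m}$, at most one for each $(C,m)$, where $P_{C,m}$ may use the special variable $\mathit{this}$. The main process is run by an actor $\aleph$, whose class has no methods and is never instantiated by the program. **Decorated semantics.** A decorated configuration ${\tt S}$ is a set of terms $A\triangleright(\sigma:P,\varnothing,q)$, at most one for each $A$, with $\sigma$ a finite sequence of naturals and $q$ a queue of messages $m(\tilde U,\sigma)$ with $\tilde U$ values. Expressions in one transition are evaluated from left to right; $\mathtt{new}\,C$ yields the least actor name of $C$ that is unused (in the configuration and in this evaluation) and adds the term $A\triangleright(\varepsilon:0,\varnothing,\varepsilon)$. The transitions ${\tt S}\xrightarrow{\alpha}{\tt S}'$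 are the following. (a) An actor with process $\sigma\cdot n:P$ performs a $\mathtt{let}$ (substituting the value), resolves a test $[E=E']P;P'$ (continuing with $P$ if the two values are equal, with $P'$ otherwise), or chooses a summand of $P+P'$; the decoration becomes $\sigma\cdot(n{+}1)$ and the label is $\sigma\cdot(n{+}1)$. (b) An actor with process $\sigma\cdot n:A'!m(\tilde E).P$ becomes $\sigma\cdot(n{+}1):P$, and $m(\tilde U,\sigma\cdot(n{+}1))$ is appended to the queue of $A'$, where $\tilde U$ are the values of $\tilde E$; the label is $\sigma\cdot(n{+}1)\,|\,m(\tilde U,A')$. (c) An actor $A\in C$ with process $0$ and first message $m(\tilde U,\sigma)$, where $C.m(\tilde x)=P$ and $|\tilde x|=|\tilde U|$, removes this message and runs $\sigma\cdot 0:P'$, where $P'$ is $P$ with $A$ for $\mathit{this}$, $\tilde U$ for $\tilde x$, and the least unused variables for the other free variables of $P$; the label is $\sigma\cdot0$. A variable is unused if it neither occurs in the configuration nor is free in the main process. **Abstract semantics.** The transitions ${\tt S}\xrightarrow{\alpha}_{\sf a}{\tt S}'$ are the same, except that messages have the form $m(\tilde U,\sigma,A')$: in (b), the message $m(\tilde U,\sigma\cdot(n{+}1),A')$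 is appended to the queue of an arbitrary existing actor of the class of $A'$ (with the same label as before); in (c), $A$ removes $m(\tilde U,\sigma,A')$ and $A'$ is substituted for $\mathit{this}$. The map $\Omega$ turns every message $m(\tilde U,\sigma)$ in the queue of each actor $A$ into $m(\tilde U,\sigma,A)$. **Equivalence.** Let $\rho,\rho'$ map the variables that are not free in the main process to values. Then $\rho\stackrel{\bullet}{=}_{\sf a}\rho'$ means that, for all such $x,y$: $\rho(x)=\rho(y)$ iff $\rho'(x)=\rho'(y)$; $\rho(x)\in C$ iff $\rho'(x)\in C$ for every class $C$; and $\rho(x)=\rho'(x)$ if $\rho(x)$ or $\rho'(x)$ is a free variable of the main process. Put $P\rho\simeq_{\sf a}P\rho'$ and $m(\tilde x)\rho\simeq_{\sf a}m(\tilde x)\rho'$ whenever $\rho\stackrel{\bullet}{=}_{\sf a}\rho'$ and $P$, $m(\tilde x)$ contain no actor names. On labels, $\sigma\simeq_{\sf a}\sigma$, and $\sigma|m(\tilde U,A)\simeq_{\sf a}\sigma|m(\tilde U',A')$ iff $m(\tilde U)\simeq_{\sf a}m(\tilde U')$ and $A,A'$ are in the same class. Write ${\tt S}|_\alpha$ for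 the process in ${\tt S}$ whose decoration is the sequence $\sigma$ of the label $\alpha$. **Proposition.** Let ${\tt S}$ be a decorated configuration and let ${\tt S}_0=\aleph\triangleright(0:P,\varnothing,\varepsilon)$ be the initial one, with $P$ the main process. 1. If ${\tt S}\xrightarrow{\alpha}{\tt S}'$ then $\Omega({\tt S})\xrightarrow{\alpha}_{\sf a}\Omega({\tt S}')$. Suppose moreover that the program is non-blocking: in every configuration reachable from ${\tt S}_0$ by $\to$, every actor whose process is not $0$ or whose queue is not empty has a transition. Then: 2. If ${\tt S}_0\xrightarrow{\alpha_1}_{\sf a}{\tt S}_1\cdots\xrightarrow{\alpha_n}_{\sf a}{\tt S}_n$, then there are a computation ${\tt S}'_0={\tt S}_0\xrightarrow{\alpha'_1}{\tt S}'_1\cdots\xrightarrow{\alpha'_m}{\tt S}'_m$ and an injection $I:\{1,\dots,n\}\to\{1,\dots,m\}$ such that, for all $1\le i\le n$, $\alpha_i\simeq_{\sf a}\alpha'_{I(i)}$, the processes ${\tt S}_i|_{\alpha_i}$ and ${\tt S}'_{I(i)}|_{\alpha'_{I(i)}}$ exist and are unique, and ${\tt S}_i|_{\alpha_i}\simeq_{\sf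 a}{\tt S}'_{I(i)}|_{\alpha'_{I(i)}}$. 3. There is an infinite computation from ${\tt S}_0$ in the abstract semantics if and only if there is one in the concrete semantics. 4. For every class $C$ and run-time process $Q$: a configuration containing an actor of class $C$ whose process is $\simeq_{\sf a}Q$ is reachable from ${\tt S}_0$ in the abstract semantics if and only if such a configuration is reachable in the concrete semantics (reachability of the control state $A\triangleright(Q,\varnothing,\varepsilon)$ with $A\in C$). -/

import Mathlib

/-! The stateless actor language: syntax, decorated (concrete) semantics, abstract semantics. -/

namespace ActorSL

abbrev ClassName := ℕ
abbrev MethodName := ℕ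
abbrev Var := ℕ

/-- Actor names: countably many, in a fixed order, for every class. `A ∈ C` is `A.cls = C`. -/
@[ext] structure ActorName where
  cls : ClassName
  idx : ℕ
deriving DecidableEq

/-- Run-time values: variables and actor names. -/
inductive Value where
  | var (x : Var)
  | actor (A : ActorName)
deriving DecidableEq

/-- Expressions with names in `α`. Classes have no fields, so there are no field expressions
and `new C` has an empty tuple of arguments. -/
inductive Expr (α : Type) where
  | name (a : α)
  | new (C : ClassName)

def Expr.map {α β : Type} (f : α → β) : Expr α → Expr β
  | .name a => .name (f a)
  | .new C => .new C

/-- The names occurring in an expression. -/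
def Expr.names {α : Type} : Expr α → List α
  | .name a => [a]
  | .new _ => []

def Expr.created {α : Type} : Expr α → List ClassName
  | .name _ => []
  | .new C => [C]

/-- Processes whose free names are in `α`, up to alpha-conversion: in `let x = E in P` the bound
variable `x` is the name `none` of the body `P`, and every name `a` of the context is `some a`.
There are no fields, hence no field updates. -/
inductive Proc : Type → Type 1 where
  | nil {α : Type} : Proc α
  | letIn {α : Type} (E : Expr α) (P : Proc (Option α)) : Proc α
  | send {α : Type} (x : α) (m : MethodName) (Es : List (Expr α)) (P : Proc α) : Proc α
  | cond {α : Type} (E E' : Expr α) (P Q : Proc α) : Proc α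
  | choice {α : Type} (P Q : Proc α) : Proc α

/-- Simultaneous capture-avoiding substitution of names for free names. -/
def Proc.map : {α : Type} → Proc α → {β : Type} → (α → β) → Proc β
  | _, .nil, _, _ => .nil
  | _, .letIn E P, _, f => .letIn (E.map f) (P.map (Option.map f))
  | _, .send x m Es P, _, f => .send (f x) m (Es.map (Expr.map f)) (P.map f)
  | _, .cond E E' P Q, _, f => .cond (E.map f) (E'.map f) (P.map f) (Q.map f)
  | _, .choice P Q, _, f => .choice (P.map f) (Q.map f)

/-- The free names of a process, in order of occurrence and possibly with repetitions. -/
def Proc.names : {α : Type} → Proc α → List α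
  | _, .nil => []
  | _, .letIn E P => E.names ++ P.names.reduceOption
  | _, .send x _ Es P => x :: (Es.flatMap Expr.names ++ P.names)
  | _, .cond E E' P Q => E.names ++ E'.names ++ P.names ++ Q.names
  | _, .choice P Q => P.names ++ Q.names

/-- The classes of the actors that a process may create. -/
def Proc.created : {α : Type} → Proc α → List ClassName
  | _, .nil => []
  | _, .letIn E P => E.created ++ P.created
  | _, .send _ _ Es P => Es.flatMap Expr.created ++ P.created
  | _, .cond E E' P Q => E.created ++ E'.created ++ P.created ++ Q.created
  | _, .choice P Q => P.created ++ Q.created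

/-- `P{U/x}` for the variable `x` bound by a `let` with body `P`. -/
def Proc.subst {α : Type} (P : Proc (Option α)) (U : α) : Proc α :=
  P.map (fun o => o.getD U)

/-- The variables of method bodies: the special variable `this`, and ordinary variables. -/
inductive BodyVar where
  | this
  | var (x : Var)

/-- A definition `C.m(params) = body`. -/
structure MethodDef where
  params : List Var
  params_nodup : params.Nodup
  body : Proc BodyVar

/-- The variables that are free in the body, other than the parameters and `this`. -/
def MethodDef.locals (d : MethodDef) : List Var :=
  (d.body.names.filterMap fun
    | .this => none
    | .var x => if x ∈ d.params then none else some x).dedup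

/-- The body with `A` for `this`, the values `Us` for the parameters, and the variables `ys` for
the remaining free variables. -/
def MethodDef.inst (d : MethodDef) (A : ActorName) (Us : List Value) (ys : List Var) :
    Proc Value :=
  d.body.map fun
    | .this => .actor A
    | .var x =>
      ((d.params.zip Us ++ d.locals.zip (ys.map Value.var)).lookup x).getD (.var x)

/-- A program: a main process, finitely many unambiguous method definitions, and the root actor
running the main process, whose class is not one of the classes of the program. -/
structure Program where
  main : Proc Var
  defs : ClassName → MethodName → Option MethodDef
  finite_defs : {c : ClassName × MethodName | defs c.1 c.2 ≠ none}.Finite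
  root : ActorName
  root_no_method : ∀ m, defs root.cls m = none
  root_not_created : root.cls ∉ main.created ∧
    ∀ C m d, defs C m = some d → root.cls ∉ d.body.created

/-- A decorated message `m(args, seq)`. -/
structure Msg where
  meth : MethodName
  args : List Value
  seq : List ℕ

/-- An abstract message `m(args, seq, target)`. -/
structure AMsg extends Msg where
  target : ActorName

class MsgNames (M : Type) where
  names : M → List Value

instance : MsgNames Msg := ⟨fun m => m.args⟩
instance : MsgNames AMsg := ⟨fun m => .actor m.target :: m.args⟩

/-- The term `(seq : proc, ∅, queue)` of an actor; the head of `queue` is the oldest message. -/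
structure Term (M : Type) where
  seq : List ℕ
  proc : Proc Value
  queue : List M

/-- Configurations: sets of terms `A ▷ (σ : P, ∅, q)`, at most one for each actor name `A`. -/
def Config (M : Type) := ActorName → Option (Term M)

/-- Replace (or add) the term of `A`. -/
def Config.set {M : Type} (S : Config M) (A : ActorName) (t : Term M) : Config M :=
  fun B => if B = A then some t else S B

/-- Add idle actors `A ▷ (ε : 0, ∅, ε)` for `A` in `As`. -/
def Config.spawn {M : Type} (S : Config M) (As : List ActorName) : Config M :=
  fun B => if B ∈ As then some ⟨[], .nil, []⟩ else S B

/-- The value `v` occurs in a process or in a queue of `S`. -/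
def Config.Occurs {M : Type} [MsgNames M] (S : Config M) (v : Value) : Prop :=
  ∃ A t, S A = some t ∧ (v ∈ t.proc.names ∨ ∃ m ∈ t.queue, v ∈ MsgNames.names m)

/-- The actor names in use in `S`. -/
def Config.usedActors {M : Type} [MsgNames M] (S : Config M) : Set ActorName :=
  {A | S A ≠ none ∨ S.Occurs (.actor A)}

/-- The variables in use: those occurring in `S` and the free variables of the main process. -/
def Config.usedVars {M : Type} [MsgNames M] (S : Config M) (p : Program) : Set Var :=
  {x | x ∈ p.main.names ∨ S.Occurs (.var x)}

/-- `Eval used Es Us As`: the expressions `Es` evaluate, from left to right, to the values `Us`,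
creating the actors `As`. A created actor has the first name of its class that is neither in
`used` nor taken earlier in the same evaluation. -/
inductive Eval : Set ActorName → List (Expr Value) → List Value → List ActorName → Prop
  | nil (used : Set ActorName) : Eval used [] [] []
  | value {used : Set ActorName} {Es Us As} (U : Value) (h : Eval used Es Us As) :
      Eval used (.name U :: Es) (U :: Us) As
  | new {used : Set ActorName} {Es Us As} (C : ClassName) (k : ℕ)
      (fresh : IsLeast {k : ℕ | ActorName.mk C k ∉ used} k)
      (h : Eval (insert ⟨C, k⟩ used) Es Us As) :
      Eval used (.new C :: Es) (.actor ⟨C, k⟩ :: Us) (⟨C, k⟩ :: As)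

/-- `FreshVars used n ys`: `ys` lists the least `n` variables that are not in `used`. -/
inductive FreshVars : Set Var → ℕ → List Var → Prop
  | zero (used : Set Var) : FreshVars used 0 []
  | succ {used : Set Var} {n : ℕ} {y : Var} {ys : List Var}
      (fresh : IsLeast {z : Var | z ∉ used} y) (h : FreshVars (insert y used) n ys) :
      FreshVars used (n + 1) (y :: ys)

/-- The moves of a process that do not involve any queue. -/
inductive ProcStep (used : Set ActorName) :
    Proc Value → Proc Value → List ActorName → Prop
  | letIn {E U As} (P : Proc (Option Value)) (h : Eval used [E] [U] As) :
      ProcStep used (.letIn E P) (P.subst U) As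
  | eq {E E' U As} (P Q : Proc Value) (h : Eval used [E, E'] [U, U] As) :
      ProcStep used (.cond E E' P Q) P As
  | ne {E E' U V As} (P Q : Proc Value) (h : Eval used [E, E'] [U, V] As) (hne : U ≠ V) :
      ProcStep used (.cond E E' P Q) Q As
  | left (P Q : Proc Value) : ProcStep used (.choice P Q) P []
  | right (P Q : Proc Value) : ProcStep used (.choice P Q) Q []

/-- Labels `σ` and `σ|m(Us, A)`. -/
inductive Label where
  | silent (σ : List ℕ)
  | send (σ : List ℕ) (m : MethodName) (Us : List Value) (A : ActorName)

def Label.seq : Label → List ℕ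
  | .silent σ => σ
  | .send σ _ _ _ => σ

/-- Decorated (concrete) transitions in which the actor `A` moves. -/
inductive CStepBy (p : Program) (A : ActorName) : Config Msg → Label → Config Msg → Prop
  | internal {S : Config Msg} {σ n P P' q As} (hA : S A = some ⟨σ ++ [n], P, q⟩)
      (hP : ProcStep S.usedActors P P' As) :
      CStepBy p A S (.silent (σ ++ [n + 1]))
        ((S.set A ⟨σ ++ [n + 1], P', q⟩).spawn As)
  | invkSelf {S : Config Msg} {σ n m Es P q Us As}
      (hA : S A = some ⟨σ ++ [n], .send (.actor A) m Es P, q⟩)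
      (hE : Eval S.usedActors Es Us As) :
      CStepBy p A S (.send (σ ++ [n + 1]) m Us A)
        ((S.set A ⟨σ ++ [n + 1], P, q ++ [⟨m, Us, σ ++ [n + 1]⟩]⟩).spawn As)
  | invk {S : Config Msg} {A' σ n m Es P q σ' P' q' Us As} (hne : A' ≠ A)
      (hA : S A = some ⟨σ ++ [n], .send (.actor A') m Es P, q⟩)
      (hA' : S A' = some ⟨σ', P', q'⟩)
      (hE : Eval S.usedActors Es Us As) :
      CStepBy p A S (.send (σ ++ [n + 1]) m Us A')
        (((S.set A ⟨σ ++ [n + 1], P, q⟩).set A'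
          ⟨σ', P', q' ++ [⟨m, Us, σ ++ [n + 1]⟩]⟩).spawn As)
  | inst {S : Config Msg} {σ' m Us σ q d ys}
      (hA : S A = some ⟨σ', .nil, ⟨m, Us, σ⟩ :: q⟩)
      (hd : p.defs A.cls m = some d) (hlen : Us.length = d.params.length)
      (hy : FreshVars (S.usedVars p) d.locals.length ys) :
      CStepBy p A S (.silent (σ ++ [0])) (S.set A ⟨σ ++ [0], d.inst A Us ys, q⟩)

/-- Abstract transitions in which the actor `A` moves: a message for `A'` may be enqueued at any
actor of the class of `A'`, and its body is instantiated with `A'` for `this`. -/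
inductive AStepBy (p : Program) (A : ActorName) : Config AMsg → Label → Config AMsg → Prop
  | internal {S : Config AMsg} {σ n P P' q As} (hA : S A = some ⟨σ ++ [n], P, q⟩)
      (hP : ProcStep S.usedActors P P' As) :
      AStepBy p A S (.silent (σ ++ [n + 1]))
        ((S.set A ⟨σ ++ [n + 1], P', q⟩).spawn As)
  | invkSelf {S : Config AMsg} {A' σ n m Es P q Us As} (hcls : A.cls = A'.cls)
      (hA : S A = some ⟨σ ++ [n], .send (.actor A') m Es P, q⟩)
      (hE : Eval S.usedActors Es Us As) :
      AStepBy p A S (.send (σ ++ [n + 1]) m Us A')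
        ((S.set A ⟨σ ++ [n + 1], P, q ++ [⟨⟨m, Us, σ ++ [n + 1]⟩, A'⟩]⟩).spawn As)
  | invk {S : Config AMsg} {A' A'' σ n m Es P q σ' P' q' Us As} (hne : A'' ≠ A)
      (hcls : A''.cls = A'.cls)
      (hA : S A = some ⟨σ ++ [n], .send (.actor A') m Es P, q⟩)
      (hA'' : S A'' = some ⟨σ', P', q'⟩)
      (hE : Eval S.usedActors Es Us As) :
      AStepBy p A S (.send (σ ++ [n + 1]) m Us A')
        (((S.set A ⟨σ ++ [n + 1], P, q⟩).set A''
          ⟨σ', P', q' ++ [⟨⟨m, Us, σ ++ [n + 1]⟩, A'⟩]⟩).spawn As)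
  | inst {S : Config AMsg} {σ' m Us σ A' q d ys}
      (hA : S A = some ⟨σ', .nil, ⟨⟨m, Us, σ⟩, A'⟩ :: q⟩)
      (hd : p.defs A.cls m = some d) (hlen : Us.length = d.params.length)
      (hy : FreshVars (S.usedVars p) d.locals.length ys) :
      AStepBy p A S (.silent (σ ++ [0])) (S.set A ⟨σ ++ [0], d.inst A' Us ys, q⟩)

def CStep (p : Program) (S : Config Msg) (α : Label) (S' : Config Msg) : Prop :=
  ∃ A, CStepBy p A S α S'

def AStep (p : Program) (S : Config AMsg) (α : Label) (S' : Config AMsg) : Prop :=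
  ∃ A, AStepBy p A S α S'

/-- The map `Ω`: every message in the queue of `A` receives the additional parameter `A`. -/
def Omega (S : Config Msg) : Config AMsg :=
  fun A => (S A).map fun t => ⟨t.seq, t.proc, t.queue.map fun m => ⟨m, A⟩⟩

/-- The initial configuration `root ▷ (0 : main, ∅, ε)`. -/
def Program.initial (p : Program) (M : Type) : Config M :=
  fun A => if A = p.root then some ⟨[0], p.main.map Value.var, []⟩ else none

/-- `S 0 -α 0-> S 1 -α 1-> ⋯ -α (n-1)-> S n` is a computation from `S₀`. -/
def IsComputation {M : Type} (step : Config M → Label → Config M → Prop) (S₀ : Config M)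
    (n : ℕ) (α : Fin n → Label) (S : Fin (n + 1) → Config M) : Prop :=
  S 0 = S₀ ∧ ∀ i : Fin n, step (S i.castSucc) (α i) (S i.succ)

def Reachable {M : Type} (step : Config M → Label → Config M → Prop) (S₀ S : Config M) : Prop :=
  Relation.ReflTransGen (fun T T' => ∃ α, step T α T') S₀ S

def HasInfiniteComputation {M : Type} (step : Config M → Label → Config M → Prop)
    (S₀ : Config M) : Prop :=
  ∃ S : ℕ → Config M, S 0 = S₀ ∧ ∀ i, ∃ α, step (S i) α (S (i + 1))

/-- In the concrete semantics no actor ever gets blocked: in every reachable configuration, every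
actor with a non-terminated process or a non-empty queue has a transition. -/
def Program.NonBlocking (p : Program) : Prop :=
  ∀ S, Reachable (CStep p) (p.initial Msg) S → ∀ A t, S A = some t →
    (t.proc ≠ .nil ∨ t.queue ≠ []) → ∃ α S', CStepBy p A S α S'

/-- `P` is the (unique) process with the decoration of the label `α` in `S`. -/
def IsProj {M : Type} (S : Config M) (α : Label) (P : Proc Value) : Prop :=
  ∀ Q, (∃ A q, S A = some ⟨α.seq, Q, q⟩) ↔ Q = P

/-- The relation on renamings of the variables that are not free in the main process. -/
def RenEq (p : Program) (ρ ρ' : Var → Value) : Prop :=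
  (∀ x y, x ∉ p.main.names → y ∉ p.main.names → (ρ x = ρ y ↔ ρ' x = ρ' y)) ∧
  (∀ x, x ∉ p.main.names → ∀ C : ClassName,
    ((∃ A : ActorName, A.cls = C ∧ ρ x = .actor A) ↔
      (∃ A : ActorName, A.cls = C ∧ ρ' x = .actor A))) ∧
  (∀ x, x ∉ p.main.names → ∀ z ∈ p.main.names,
    (ρ x = .var z ∨ ρ' x = .var z) → ρ x = ρ' x)

open Classical in
/-- The action of a renaming, which leaves the free variables of the main process unchanged. -/
noncomputable def ren (p : Program) (ρ : Var → Value) (x : Var) : Value :=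
  if x ∈ p.main.names then .var x else ρ x

/-- `P ≃ₐ P'`: both are renamings, by related renamings, of one process over variables. -/
def ProcEquiv (p : Program) (P P' : Proc Value) : Prop :=
  ∃ (Q : Proc Var) (ρ ρ' : Var → Value), RenEq p ρ ρ' ∧
    P = Q.map (ren p ρ) ∧ P' = Q.map (ren p ρ')

/-- `m(Us) ≃ₐ m'(Us')`. -/
def InvEquiv (p : Program) (m : MethodName) (Us : List Value) (m' : MethodName)
    (Us' : List Value) : Prop :=
  m = m' ∧ ∃ (xs : List Var) (ρ ρ' : Var → Value), RenEq p ρ ρ' ∧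
    Us = xs.map (ren p ρ) ∧ Us' = xs.map (ren p ρ')

/-- `α ≃ₐ α'` on labels. -/
def LabelEquiv (p : Program) : Label → Label → Prop
  | .silent σ, .silent σ' => σ = σ'
  | .send σ m Us A, .send σ' m' Us' A' =>
      σ = σ' ∧ InvEquiv p m Us m' Us' ∧ A.cls = A'.cls
  | _, _ => False

/-- Reachability of the control state `A ▷ (Q, ∅, ε)` with `A` in `C`: some reachable
configuration contains an actor of class `C` whose process is `≃ₐ`-equivalent to `Q`. -/
def ReachesControl {M : Type} (p : Program) (step : Config M → Label → Config M → Prop)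
    (S₀ : Config M) (C : ClassName) (Q : Proc Value) : Prop :=
  ∃ S, Reachable step S₀ S ∧ ∃ A t, S A = some t ∧ A.cls = C ∧ ProcEquiv p Q t.proc

end ActorSL

open ActorSL

namespace ActorSL

/-! ### Renaming of expressions and processes -/

/-! Classes have no fields, so what a method body does depends only on the message that started it
(arguments, value of `this`) and on how its choices are resolved. The actor that runs it and the
interleaving affect only which fresh names get allocated. Names are merely passed on, compared for
equality, or used as targets whose class selects a method, so the particular names are irrelevant as
long as distinct ones stay distinct.

To make this precise, fix an oracle `o` that resolves the choice made at each decoration. It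
determines a symbolic execution: `Tree` assigns to a decoration at most one class and one process
(`Tree.unique`), in which every allocated name is represented by its place of origin. `SymInv` says
that a configuration of an abstract run following `o` is the image of tree nodes and tree messages
under an interpretation `ν` of symbolic names that is injective on the names still present.
Injectivity makes actual tests agree with symbolic ones (`Move.symbolic`). Concrete runs inherit the
invariant through `Omega`, which preserves labels because it does not change the sets of used names.
Decorations never repeat in a run (`SeqInv.fresh`), so every abstract run follows some oracle
(`exists_oracle`).

Non-blocking is used to explore the tree concretely. Each move of a running process makes it
smaller, so an actor that is scheduled alone terminates and then consumes its queue. Hence every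
concrete run following `o` extends to one that performs any prescribed node
(`Program.NonBlocking.run_tree`). Given an abstract run, it suffices to perform all its decorations
concretely and to match transitions with equal decorations: both are instances of one tree node
under injective interpretations of the same kinds, hence equivalent (`Run.compare`). An infinite
abstract run visits infinitely many nodes, so no finite concrete run exhausts them. A reachable
control state is either a tree node or a created actor that has not run yet, and both are realised
concretely. The converse directions follow from `Omega`. -/

theorem Expr.map_map {α β γ : Type} (f : α → β) (g : β → γ) (E : Expr α) :
    (E.map f).map g = E.map (g ∘ f) := by
  cases E <;> rfl

theorem Expr.names_map {α β : Type} (f : α → β) (E : Expr α) :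
    (E.map f).names = E.names.map f := by
  cases E <;> rfl

theorem Expr.map_congr {α β : Type} {f g : α → β} {E : Expr α}
    (h : ∀ a ∈ E.names, f a = g a) : E.map f = E.map g := by
  cases E with
  | name a => simp [Expr.map, h a (by simp [Expr.names])]
  | new C => rfl

theorem Expr.flatMap_names_map {α β : Type} (f : α → β) (Es : List (Expr α)) :
    (Es.map (Expr.map f)).flatMap Expr.names = (Es.flatMap Expr.names).map f := by
  induction Es with
  | nil => rfl
  | cons E Es ih => simp [Expr.names_map, ih]

theorem Proc.map_map {α β γ : Type} (P : Proc α) (f : α → β) (g : β → γ) :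
    (P.map f).map g = P.map (g ∘ f) := by
  induction P generalizing β γ with
  | nil => rfl
  | letIn E P ih => simp [Proc.map, Expr.map_map, ih, Option.map_comp_map]
  | send x m Es P ih => simp [Proc.map, Expr.map_map, ih, Function.comp_def]
  | cond E E' P Q ihP ihQ => simp [Proc.map, Expr.map_map, ihP, ihQ]
  | choice P Q ihP ihQ => simp [Proc.map, ihP, ihQ]

theorem Proc.names_map {α β : Type} (P : Proc α) (f : α → β) :
    (P.map f).names = P.names.map f := by
  induction P generalizing β with
  | nil => rfl
  | letIn E P ih => simp [Proc.map, Proc.names, Expr.names_map, ih]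
  | send x m Es P ih => simp [Proc.map, Proc.names, Expr.flatMap_names_map, ih]
  | cond E E' P Q ihP ihQ => simp [Proc.map, Proc.names, Expr.names_map, ihP, ihQ]
  | choice P Q ihP ihQ => simp [Proc.map, Proc.names, ihP, ihQ]

theorem Proc.map_congr {α β : Type} (P : Proc α) {f g : α → β}
    (h : ∀ a ∈ P.names, f a = g a) : P.map f = P.map g := by
  induction P generalizing β with
  | nil => rfl
  | letIn E P ih =>
    simp only [Proc.names, List.mem_append, List.reduceOption_mem_iff] at h
    simp only [Proc.map]
    rw [Expr.map_congr (fun a ha => h a (.inl ha)), ih]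
    rintro (_ | a) ha
    · rfl
    · simp [h a (.inr ha)]
  | send x m Es P ih =>
    simp only [Proc.names, List.mem_cons, List.mem_append, List.mem_flatMap] at h
    simp only [Proc.map]
    rw [h x (.inl rfl), ih fun a ha => h a (.inr (.inr ha))]
    congr 1
    exact List.map_congr_left fun E hE =>
      Expr.map_congr fun a ha => h a (.inr (.inl ⟨E, hE, ha⟩))
  | cond E E' P Q ihP ihQ =>
    simp only [Proc.names, List.mem_append] at h
    simp only [Proc.map]
    rw [Expr.map_congr (E := E) (fun a ha => h a (by simp [ha])),
      Expr.map_congr (E := E') (fun a ha => h a (by simp [ha])),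
      ihP fun a ha => h a (by simp [ha]), ihQ fun a ha => h a (by simp [ha])]
  | choice P Q ihP ihQ =>
    simp only [Proc.names, List.mem_append] at h
    simp only [Proc.map]
    rw [ihP fun a ha => h a (by simp [ha]), ihQ fun a ha => h a (by simp [ha])]

theorem Proc.map_id' {α : Type} (P : Proc α) {f : α → α} (h : ∀ a ∈ P.names, f a = a) :
    P.map f = P := by
  induction P with
  | nil => rfl
  | letIn E P ih =>
    simp only [Proc.names, List.mem_append, List.reduceOption_mem_iff] at h
    simp only [Proc.map]
    rw [ih]
    · cases E <;> simp_all [Expr.map, Expr.names]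
    · rintro (_ | a) ha
      · rfl
      · simp [h a (.inr ha)]
  | send x m Es P ih =>
    simp only [Proc.names, List.mem_cons, List.mem_append, List.mem_flatMap] at h
    simp only [Proc.map]
    rw [h x (.inl rfl), ih fun a ha => h a (.inr (.inr ha))]
    congr 1
    rw [List.map_congr_left (g := id), List.map_id]
    intro E hE
    cases E with
    | name a => simp [Expr.map, h a (.inr (.inl ⟨_, hE, by simp [Expr.names]⟩))]
    | new C => rfl
  | cond E E' P Q ihP ihQ =>
    simp only [Proc.names, List.mem_append] at h
    simp only [Proc.map]
    rw [ihP fun a ha => h a (by simp [ha]), ihQ fun a ha => h a (by simp [ha])]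
    congr 1
    · cases E <;> simp_all [Expr.map, Expr.names]
    · cases E' <;> simp_all [Expr.map, Expr.names]
  | choice P Q ihP ihQ =>
    simp only [Proc.names, List.mem_append] at h
    simp only [Proc.map]
    rw [ihP fun a ha => h a (by simp [ha]), ihQ fun a ha => h a (by simp [ha])]

theorem Proc.map_subst {α β : Type} (P : Proc (Option α)) (u : α) (f : α → β) :
    (P.subst u).map f = (P.map (Option.map f)).subst (f u) := by
  simp only [Proc.subst, Proc.map_map]
  congr 1
  funext o
  cases o <;> rfl

theorem Proc.mem_names_subst {α : Type} {P : Proc (Option α)} {u a : α}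
    (h : a ∈ (P.subst u).names) : a = u ∨ a ∈ P.names.reduceOption := by
  simp only [Proc.subst, Proc.names_map, List.mem_map] at h
  obtain ⟨_ | b, hb, rfl⟩ := h
  · exact .inl rfl
  · exact .inr (List.reduceOption_mem_iff.2 hb)

/-- The number of constructors of a process. -/
def Proc.size : {α : Type} → Proc α → ℕ
  | _, .nil => 0
  | _, .letIn _ P => P.size + 1
  | _, .send _ _ _ P => P.size + 1
  | _, .cond _ _ P Q => P.size + Q.size + 1
  | _, .choice P Q => P.size + Q.size + 1

theorem Proc.size_map {α β : Type} (P : Proc α) (f : α → β) : (P.map f).size = P.size := by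
  induction P generalizing β with
  | nil => rfl
  | letIn E P ih => simp [Proc.map, Proc.size, ih]
  | send x m Es P ih => simp [Proc.map, Proc.size, ih]
  | cond E E' P Q ihP ihQ => simp [Proc.map, Proc.size, ihP, ihQ]
  | choice P Q ihP ihQ => simp [Proc.map, Proc.size, ihP, ihQ]

theorem Proc.map_eq_nil {α β : Type} {P : Proc α} {f : α → β} (h : P.map f = .nil) :
    P = .nil := by
  cases P <;> simp_all [Proc.map]

/-! ### The equivalence of renamings -/

/-- `f` preserves the kind of the value `v`: free variables of the main process are fixed, other
variables stay such, and actors stay in their class. -/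
def KindPreserving (p : Program) (v w : Value) : Prop :=
  (∀ x, v = .var x → x ∈ p.main.names → w = v) ∧
  (∀ x, v = .var x → x ∉ p.main.names → ∃ y, y ∉ p.main.names ∧ w = .var y) ∧
  (∀ A, v = .actor A → ∃ B : ActorName, B.cls = A.cls ∧ w = .actor B)

theorem KindPreserving.refl (p : Program) (v : Value) : KindPreserving p v v :=
  ⟨fun _ _ _ => rfl, fun x h hx => ⟨x, hx, h⟩, fun A h => ⟨A, rfl, h⟩⟩

theorem KindPreserving.symm {p : Program} {v w : Value} (h : KindPreserving p v w) :
    KindPreserving p w v := by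
  obtain ⟨h1, h2, h3⟩ := h
  cases v with
  | var x =>
    by_cases hx : x ∈ p.main.names
    · rw [h1 x rfl hx]; exact .refl p _
    · obtain ⟨y, hy, rfl⟩ := h2 x rfl hx
      exact ⟨fun z hz hz' => by cases hz; exact absurd hz' hy, fun _ _ _ => ⟨x, hx, rfl⟩,
        fun A hA => by cases hA⟩
  | actor A =>
    obtain ⟨B, hB, rfl⟩ := h3 A rfl
    exact ⟨fun z hz => (by cases hz), fun z hz => (by cases hz),
      fun B' hB' => by cases hB'; exact ⟨A, hB.symm, rfl⟩⟩

theorem KindPreserving.trans {p : Program} {u v w : Value} (h : KindPreserving p u v)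
    (h' : KindPreserving p v w) : KindPreserving p u w := by
  obtain ⟨h1, h2, h3⟩ := h
  obtain ⟨k1, k2, k3⟩ := h'
  cases u with
  | var x =>
    by_cases hx : x ∈ p.main.names
    · cases h1 x rfl hx; exact ⟨k1, k2, k3⟩
    · obtain ⟨y, hy, rfl⟩ := h2 x rfl hx
      exact ⟨fun z hz hz' => by cases hz; exact absurd hz' hx, fun _ _ _ => k2 y rfl hy,
        fun A hA => by cases hA⟩
  | actor A =>
    obtain ⟨B, hB, rfl⟩ := h3 A rfl
    refine ⟨fun z hz => (by cases hz), fun z hz => (by cases hz), fun B' hB' => ?_⟩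
    cases hB'
    obtain ⟨B2, hB2, rfl⟩ := k3 B rfl
    exact ⟨B2, hB2.trans hB, rfl⟩

/-- An injective numbering of values by variables which are not free in the main process. -/
noncomputable def Value.code (p : Program) : Value → Var
  -- The sum of a list bounds each of its entries, so codes exceed every free variable of the main
  -- process; parity separates variables from actors.
  | .var x => p.main.names.sum + 1 + 2 * x
  | .actor A => p.main.names.sum + 1 + 2 * Nat.pair A.cls A.idx + 1

theorem Value.code_injective (p : Program) : Function.Injective (Value.code p) := by
  rintro (x | ⟨c, i⟩) (y | ⟨c', i'⟩) h <;> simp only [Value.code, Var] at *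
  · rw [Nat.eq_of_mul_eq_mul_left two_pos (Nat.add_left_cancel h)]
  · omega
  · omega
  · have : Nat.pair c i = Nat.pair c' i' := by omega
    obtain ⟨rfl, rfl⟩ := Nat.pair_eq_pair.1 this
    rfl

theorem Value.code_notMem (p : Program) (v : Value) : v.code p ∉ p.main.names := by
  intro h
  have := List.le_sum_of_mem h
  cases v <;> simp only [Value.code, Var] at * <;> omega

theorem exists_var_notMem (s : List Value) (l : List Var) :
    ∃ x, x ∉ l ∧ Value.var x ∉ s := by
  obtain ⟨x, hx⟩ := Infinite.exists_notMem_finset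
    (l.toFinset ∪ (s.filterMap fun v => match v with | .var x => some x | _ => none).toFinset)
  simp only [Finset.mem_union, List.mem_toFinset, not_or, List.mem_filterMap] at hx
  exact ⟨x, hx.1, fun h => hx.2 ⟨_, h, rfl⟩⟩

/-- Values related by an injective kind-preserving map are images of variables under related
renamings. -/
theorem exists_renEq (p : Program) (s : List Value) (f : Value → Value)
    (inj : ∀ v ∈ s, ∀ w ∈ s, f v = f w → v = w) (kind : ∀ v ∈ s, KindPreserving p v (f v)) :
    ∃ (e : Value → Var) (ρ ρ' : Var → Value), RenEq p ρ ρ' ∧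
      ∀ v ∈ s, ren p ρ (e v) = v ∧ ren p ρ' (e v) = f v := by
  classical
  obtain ⟨d, hd, hds⟩ := exists_var_notMem (s ++ s.map f) p.main.names
  rw [List.mem_append, not_or] at hds
  have hcode : ∀ x, (∃ v ∈ s, v.code p = x) ∨ ¬ ∃ v ∈ s, v.code p = x := fun x => em _
  -- Variables that code no value of `s` all go to one spare variable `d`, which is neither in `s`
  -- nor an image of `s` under `f`; hence both renamings make the same identifications.
  let ρ : (Value → Value) → Var → Value := fun g x =>
    if h : ∃ v ∈ s, v.code p = x then g h.choose else .var d
  have ρ_code : ∀ g, ∀ v ∈ s, ρ g (v.code p) = g v := by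
    intro g v hv
    have h : ∃ w ∈ s, w.code p = v.code p := ⟨v, hv, rfl⟩
    simp only [ρ, dif_pos h]
    rw [Value.code_injective p h.choose_spec.2]
  have ρ_else : ∀ g x, (¬ ∃ v ∈ s, v.code p = x) → ρ g x = .var d := fun g x h => dif_neg h
  refine ⟨fun v => v.code p, ρ id, ρ f, ⟨?_, ?_, ?_⟩, ?_⟩
  · intro x y _ _
    rcases hcode x with ⟨v, hv, rfl⟩ | hx <;> rcases hcode y with ⟨w, hw, rfl⟩ | hy
    · rw [ρ_code _ v hv, ρ_code _ w hw, ρ_code _ v hv, ρ_code _ w hw]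
      exact ⟨fun h => congrArg f h, fun h => inj v hv w hw h⟩
    · rw [ρ_code _ v hv, ρ_code _ v hv, ρ_else _ y hy, ρ_else _ y hy]
      exact ⟨fun h => absurd (h ▸ hv) hds.1,
        fun h => absurd (h ▸ List.mem_map_of_mem hv) hds.2⟩
    · rw [ρ_code _ w hw, ρ_code _ w hw, ρ_else _ x hx, ρ_else _ x hx]
      exact ⟨fun h => absurd (h ▸ hw) hds.1,
        fun h => absurd (h ▸ List.mem_map_of_mem hw) hds.2⟩
    · rw [ρ_else _ x hx, ρ_else _ x hx, ρ_else _ y hy, ρ_else _ y hy]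
  · intro x _ C
    rcases hcode x with ⟨v, hv, rfl⟩ | hx
    · rw [ρ_code _ v hv, ρ_code _ v hv]
      constructor
      · rintro ⟨A, hA, h⟩
        obtain ⟨B, hB, h'⟩ := (kind v hv).2.2 A h
        exact ⟨B, hB.trans hA, h'⟩
      · rintro ⟨A, hA, h⟩
        obtain ⟨B, hB, h'⟩ := (kind v hv).symm.2.2 A h
        exact ⟨B, hB.trans hA, h'⟩
    · rw [ρ_else _ x hx, ρ_else _ x hx]
  · intro x _ z hz
    rcases hcode x with ⟨v, hv, rfl⟩ | hx
    · rw [ρ_code _ v hv, ρ_code _ v hv]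
      rintro (h | h)
      · exact ((kind v hv).1 z h hz).symm
      · exact (kind v hv).symm.1 z h hz
    · rw [ρ_else _ x hx, ρ_else _ x hx]
      exact fun _ => rfl
  · intro v hv
    have := Value.code_notMem p v
    exact ⟨by rw [ren, if_neg this, ρ_code _ v hv]; rfl, by rw [ren, if_neg this, ρ_code _ v hv]⟩

/-- An identification with a free variable of the main process transfers by the third clause of
`RenEq`, all others by the first. -/
theorem ren_eq_iff {p : Program} {ρ ρ' : Var → Value} (h : RenEq p ρ ρ') (x y : Var) :
    ren p ρ x = ren p ρ y ↔ ren p ρ' x = ren p ρ' y := by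
  simp only [ren]
  split_ifs with hx hy hy
  · rfl
  · have := h.2.2 y hy x hx
    constructor
    · intro e; rw [← this (.inl e.symm)]; exact e
    · intro e; rw [this (.inr e.symm)]; exact e
  · have := h.2.2 x hx y hy
    constructor
    · intro e; rw [← this (.inl e)]; exact e
    · intro e; rw [this (.inr e)]; exact e
  · exact h.1 x y hx hy

/-- A variable cannot become an actor, since membership in classes is shared, nor can it become a
free variable of the main process, since the third clause of `RenEq` would then force equality. -/
theorem kindPreserving_ren {p : Program} {ρ ρ' : Var → Value} (h : RenEq p ρ ρ') (x : Var) :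
    KindPreserving p (ren p ρ x) (ren p ρ' x) := by
  simp only [ren]
  split_ifs with hx
  · exact .refl p _
  · refine ⟨fun z hz hz' => (h.2.2 x hx z hz' (.inl hz)).symm, fun z hz hz' => ?_, fun A hA => ?_⟩
    · cases hv : ρ' x with
      | var y =>
        refine ⟨y, fun hy => hz' ?_, rfl⟩
        have e := h.2.2 x hx y hy (.inr hv)
        rw [hz, hv] at e
        cases e
        exact hy
      | actor A =>
        obtain ⟨B, _, hB⟩ := (h.2.1 x hx A.cls).2 ⟨A, rfl, hv⟩
        rw [hz] at hB
        cases hB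
    · exact (h.2.1 x hx A.cls).1 ⟨A, rfl, hA⟩

/-- The map `f` is the second renaming after a section of the first, which is well defined because
both identify the same variables. Eliminating the intermediate process reduces transitivity to
composition of maps. -/
theorem procEquiv_iff {p : Program} {P P' : Proc Value} :
    ProcEquiv p P P' ↔ ∃ f : Value → Value, P' = P.map f ∧
      (∀ v ∈ P.names, ∀ w ∈ P.names, f v = f w → v = w) ∧
      ∀ v ∈ P.names, KindPreserving p v (f v) := by
  classical
  constructor
  · rintro ⟨Q, ρ, ρ', h, rfl, rfl⟩
    let f : Value → Value := fun v => if hv : ∃ x, ren p ρ x = v then ren p ρ' hv.choose else v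
    have hf : ∀ x, f (ren p ρ x) = ren p ρ' x := by
      intro x
      have hv : ∃ y, ren p ρ y = ren p ρ x := ⟨x, rfl⟩
      simp only [f, dif_pos hv]
      exact (ren_eq_iff h _ _).1 hv.choose_spec
    refine ⟨f, ?_, ?_, ?_⟩
    · rw [Proc.map_map]
      exact Proc.map_congr _ fun x _ => (hf x).symm
    · simp only [Proc.names_map, List.mem_map]
      rintro _ ⟨x, _, rfl⟩ _ ⟨y, _, rfl⟩ e
      rw [hf, hf] at e
      exact (ren_eq_iff h _ _).2 e
    · simp only [Proc.names_map, List.mem_map]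
      rintro _ ⟨x, _, rfl⟩
      rw [hf]
      exact kindPreserving_ren h x
  · rintro ⟨f, rfl, inj, kind⟩
    obtain ⟨e, ρ, ρ', h, he⟩ := exists_renEq p P.names f inj kind
    refine ⟨P.map e, ρ, ρ', h, ?_, ?_⟩
    · rw [Proc.map_map]
      exact (Proc.map_id' _ fun v hv => (he v hv).1).symm
    · rw [Proc.map_map]
      exact Proc.map_congr _ fun v hv => ((he v hv).2).symm

theorem ProcEquiv.trans {p : Program} {P Q R : Proc Value} (h : ProcEquiv p P Q)
    (h' : ProcEquiv p Q R) : ProcEquiv p P R := by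
  rw [procEquiv_iff] at *
  obtain ⟨f, rfl, hf, kf⟩ := h
  obtain ⟨g, rfl, hg, kg⟩ := h'
  simp only [Proc.names_map, List.mem_map, forall_exists_index, and_imp,
    forall_apply_eq_imp_iff₂] at hg kg
  exact ⟨g ∘ f, Proc.map_map .., fun v hv w hw e => hf v hv w hw (hg v hv w hw e),
    fun v hv => (kf v hv).trans (kg v hv)⟩

/-- The transition map between two injective interpretations of the same names. -/
theorem exists_transition {ι : Type} (p : Program) (s : List ι) (ν ν' : ι → Value)
    (inj : ∀ a ∈ s, ∀ b ∈ s, ν a = ν b → a = b)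
    (inj' : ∀ a ∈ s, ∀ b ∈ s, ν' a = ν' b → a = b)
    (kind : ∀ a ∈ s, KindPreserving p (ν a) (ν' a)) :
    ∃ f : Value → Value, (∀ a ∈ s, f (ν a) = ν' a) ∧
      (∀ v ∈ s.map ν, ∀ w ∈ s.map ν, f v = f w → v = w) ∧
      ∀ v ∈ s.map ν, KindPreserving p v (f v) := by
  classical
  let f : Value → Value := fun v => if hv : ∃ a ∈ s, ν a = v then ν' hv.choose else v
  have hf : ∀ a ∈ s, f (ν a) = ν' a := by
    intro a ha
    have hv : ∃ b ∈ s, ν b = ν a := ⟨a, ha, rfl⟩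
    simp only [f, dif_pos hv]
    rw [inj _ hv.choose_spec.1 a ha hv.choose_spec.2]
  refine ⟨f, hf, ?_, ?_⟩
  · simp only [List.mem_map]
    rintro _ ⟨a, ha, rfl⟩ _ ⟨b, hb, rfl⟩ e
    rw [hf a ha, hf b hb] at e
    rw [inj' a ha b hb e]
  · simp only [List.mem_map]
    rintro _ ⟨a, ha, rfl⟩
    rw [hf a ha]
    exact kind a ha

/-- This is how equivalences are obtained later: one symbolic process read under two
interpretations. -/
theorem procEquiv_map {ι : Type} {p : Program} (Q : Proc ι) (ν ν' : ι → Value)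
    (inj : ∀ a ∈ Q.names, ∀ b ∈ Q.names, ν a = ν b → a = b)
    (inj' : ∀ a ∈ Q.names, ∀ b ∈ Q.names, ν' a = ν' b → a = b)
    (kind : ∀ a ∈ Q.names, KindPreserving p (ν a) (ν' a)) :
    ProcEquiv p (Q.map ν) (Q.map ν') := by
  obtain ⟨f, h1, h2, h3⟩ := exists_transition p Q.names ν ν' inj inj' kind
  rw [procEquiv_iff]
  refine ⟨f, ?_, by rwa [Proc.names_map], by rwa [Proc.names_map]⟩
  rw [Proc.map_map]
  exact Proc.map_congr _ fun a ha => (h1 a ha).symm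

theorem invEquiv_map {ι : Type} {p : Program} (m : MethodName) (us : List ι) (ν ν' : ι → Value)
    (inj : ∀ a ∈ us, ∀ b ∈ us, ν a = ν b → a = b)
    (inj' : ∀ a ∈ us, ∀ b ∈ us, ν' a = ν' b → a = b)
    (kind : ∀ a ∈ us, KindPreserving p (ν a) (ν' a)) :
    InvEquiv p m (us.map ν) m (us.map ν') := by
  obtain ⟨f, h1, h2, h3⟩ := exists_transition p us ν ν' inj inj' kind
  obtain ⟨e, ρ, ρ', h, he⟩ := exists_renEq p (us.map ν) f h2 h3
  refine ⟨rfl, us.map (e ∘ ν), ρ, ρ', h, ?_, ?_⟩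
  · rw [List.map_map]
    exact List.map_congr_left fun a ha => ((he _ (List.mem_map_of_mem ha)).1).symm
  · rw [List.map_map]
    refine List.map_congr_left fun a ha => ?_
    rw [Function.comp_apply, Function.comp_apply, (he _ (List.mem_map_of_mem ha)).2, h1 a ha]

/-! ### Symbolic execution

A name is represented by its origin: the main process, or the decoration of the transition that
allocated it and its rank in this transition. -/

inductive SName where
  | main (x : Var)
  | fvar (σ : List ℕ) (k : ℕ)
  | act (σ : List ℕ) (k : ℕ) (C : ClassName)

/-- The decoration of the transition that allocated a name. -/
def SName.origin : SName → List ℕ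
  | .main _ => []
  | .fvar σ _ => σ
  | .act σ _ _ => σ

/-- Symbolic evaluation in the transition `σ`, in which `k` actors have already been created. -/
def seval (σ : List ℕ) : ℕ → List (Expr SName) → List SName
  | _, [] => []
  | k, .name a :: Es => a :: seval σ k Es
  | k, .new C :: Es => .act σ k C :: seval σ (k + 1) Es

def sevalOne (σ : List ℕ) : Expr SName → SName
  | .name a => a
  | .new C => .act σ 0 C

open Classical in
/-- The symbolic process after the transition `σ`, where `o` resolves the choices. -/
noncomputable def sstep (o : List ℕ → Bool) (σ : List ℕ) : Proc SName → Option (Proc SName)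
  | .nil => none
  | .letIn E P => some (P.subst (sevalOne σ E))
  | .send _ _ _ P => some P
  | .cond E E' P Q =>
    -- Origins are compared instead of values; this gives the actual outcome under any
    -- interpretation injective on the names involved.
    some (if ∃ u, seval σ 0 [E, E'] = [u, u] then P else Q)
  | .choice P Q => some (if o σ then P else Q)

/-- The classes of the actors created by the first transition of a process. -/
def Proc.headCreated {α : Type} : Proc α → List ClassName
  | .nil => []
  | .letIn E _ => E.created
  | .send _ _ Es _ => Es.flatMap Expr.created
  | .cond E E' _ _ => E.created ++ E'.created
  | .choice _ _ => []

/-- Symbolic instantiation of a method body in the transition `σ`. -/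
def MethodDef.sinst (d : MethodDef) (a : SName) (us : List SName) (σ : List ℕ) : Proc SName :=
  d.body.map fun
    | .this => a
    | .var x =>
      ((d.params.zip us ++
        d.locals.zip ((List.range d.locals.length).map (SName.fvar σ))).lookup x).getD (.main x)

/-- `Tree p o σ c Q`: the process with decoration `σ` is `Q`, and it is run by an actor of the
class `c`, if choices are resolved by `o`. -/
inductive Tree (p : Program) (o : List ℕ → Bool) : List ℕ → ClassName → Proc SName → Prop
  | root : Tree p o [0] p.root.cls (p.main.map SName.main)
  | step {σ n c Q Q'} (h : Tree p o (σ ++ [n]) c Q) (hs : sstep o (σ ++ [n + 1]) Q = some Q') :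
      Tree p o (σ ++ [n + 1]) c Q'
  | inst {σ n c τ k C m Es P d} (h : Tree p o (σ ++ [n]) c (.send (.act τ k C) m Es P))
      (hd : p.defs C m = some d) (hlen : Es.length = d.params.length) :
      Tree p o (σ ++ [n + 1] ++ [0]) C
        (d.sinst (.act τ k C) (seval (σ ++ [n + 1]) 0 Es) (σ ++ [n + 1] ++ [0]))

structure SMsg where
  meth : MethodName
  args : List SName
  target : SName

def SMsg.names (M : SMsg) : List SName := M.target :: M.args

/-- `TMsg p o σ C M`: the transition `σ` sends `M` to an actor of class `C`. -/
inductive TMsg (p : Program) (o : List ℕ → Bool) : List ℕ → ClassName → SMsg → Prop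
  | mk {σ n c τ k C m Es P} (h : Tree p o (σ ++ [n]) c (.send (.act τ k C) m Es P)) :
      TMsg p o (σ ++ [n + 1]) C ⟨m, seval (σ ++ [n + 1]) 0 Es, .act τ k C⟩

/-- `Creates p o σ C`: the transition `σ` creates an actor of class `C`. -/
def Creates (p : Program) (o : List ℕ → Bool) (σ : List ℕ) (C : ClassName) : Prop :=
  ∃ τ n c Q, σ = τ ++ [n + 1] ∧ Tree p o (τ ++ [n]) c Q ∧ C ∈ Q.headCreated

/-! ### Determinism of the symbolic execution. -/

theorem snoc_inj {α : Type} {s t : List α} {a b : α} : s ++ [a] = t ++ [b] ↔ s = t ∧ a = b := by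
  constructor
  · intro h
    obtain ⟨h1, h2⟩ := List.append_inj' h rfl
    exact ⟨h1, by simpa using h2⟩
  · rintro ⟨rfl, rfl⟩; rfl

theorem Tree.ne_nil {p : Program} {o σ c Q} (h : Tree p o σ c Q) : σ ≠ [] := by
  cases h <;> simp

theorem Tree.succ_inv {p : Program} {o σ n c Q} (h : Tree p o (σ ++ [n + 1]) c Q) :
    ∃ Q', Tree p o (σ ++ [n]) c Q' ∧ sstep o (σ ++ [n + 1]) Q' = some Q := by
  generalize hτ : σ ++ [n + 1] = τ at h
  cases h with
  | root =>
    have := snoc_inj (s := σ) (t := []).1 hτ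
    omega
  | step h hs =>
    obtain ⟨rfl, h'⟩ := snoc_inj.1 hτ
    obtain rfl : n = _ := Nat.succ.inj h'
    exact ⟨_, h, hs⟩
  | inst h hd hlen =>
    have := (snoc_inj.1 hτ).2
    omega

theorem Tree.zero_inv {p : Program} {o σ c Q} (h : Tree p o (σ ++ [0]) c Q) :
    (σ = [] ∧ c = p.root.cls ∧ Q = p.main.map SName.main) ∨
    ∃ τ n c' ρ k m Es P d, σ = τ ++ [n + 1] ∧
      Tree p o (τ ++ [n]) c' (.send (.act ρ k c) m Es P) ∧ p.defs c m = some d ∧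
      Es.length = d.params.length ∧
      Q = d.sinst (.act ρ k c) (seval (τ ++ [n + 1]) 0 Es) (τ ++ [n + 1] ++ [0]) := by
  generalize hτ : σ ++ [0] = τ at h
  cases h with
  | root => exact .inl ⟨(snoc_inj (s := σ) (t := []).1 hτ).1, rfl, rfl⟩
  | step h hs =>
    have := (snoc_inj.1 hτ).2
    omega
  | inst h hd hlen => exact .inr ⟨_, _, _, _, _, _, _, _, _, (snoc_inj.1 hτ).1, h, hd, hlen, rfl⟩

/-- The decoration determines the last rule: a final successor comes from `step`, a final zero from
`root` or `inst`, and these two differ in whether the prefix is empty. So the predecessor is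
determined, and `sstep` is a function. -/
theorem Tree.unique {p : Program} {o σ c Q} (h : Tree p o σ c Q) :
    ∀ {c' Q'}, Tree p o σ c' Q' → c = c' ∧ Q = Q' := by
  induction h with
  | root =>
    intro c' Q' h
    rcases Tree.zero_inv (σ := []) h with ⟨_, rfl, rfl⟩ | ⟨τ, n, _, _, _, _, _, _, _, h, _⟩
    · exact ⟨rfl, rfl⟩
    · simp at h
  | step h hs ih =>
    intro c' Q' h'
    obtain ⟨Q0, h0, hs0⟩ := h'.succ_inv
    obtain ⟨rfl, rfl⟩ := ih h0
    exact ⟨rfl, Option.some.inj (hs.symm.trans hs0)⟩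
  | inst h hd hlen ih =>
    intro c' Q' h'
    rcases h'.zero_inv with ⟨h0, _⟩ | ⟨τ, n, c2, ρ, k, m, Es, P, d, hτ, h0, hd', hl, rfl⟩
    · simp at h0
    · obtain ⟨rfl, hn⟩ := snoc_inj.1 hτ
      obtain rfl := Nat.succ.inj hn
      obtain ⟨_, e⟩ := ih h0
      injection e with _ e1 e2 e3 e4
      injection e1 with e5 e6 e7
      subst e2 e3 e5 e6 e7
      rw [hd] at hd'
      cases hd'
      exact ⟨rfl, rfl⟩

theorem TMsg.unique {p : Program} {o σ C M C' M'} (h : TMsg p o σ C M)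
    (h' : TMsg p o σ C' M') : C = C' ∧ M = M' := by
  cases h with
  | mk h =>
    generalize hτ : _ ++ [_ + 1] = τ at h'
    cases h' with
    | mk h' =>
      obtain ⟨rfl, hn⟩ := snoc_inj.1 hτ
      obtain rfl := Nat.succ.inj hn
      obtain ⟨_, e⟩ := h.unique h'
      injection e with _ e1 e2 e3 e4
      injection e1 with e5 e6 e7
      subst e2 e3 e5 e6 e7
      exact ⟨rfl, rfl⟩

theorem seval_length (σ : List ℕ) (k : ℕ) (Es : List (Expr SName)) :
    (seval σ k Es).length = Es.length := by
  induction Es generalizing k with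
  | nil => rfl
  | cons E Es ih => cases E <;> simp [seval, ih]

theorem TMsg.inst {p : Program} {o σ C M d} (h : TMsg p o σ C M) (hd : p.defs C M.meth = some d)
    (hlen : M.args.length = d.params.length) :
    Tree p o (σ ++ [0]) C (d.sinst M.target M.args (σ ++ [0])) := by
  cases h with
  | mk h => exact .inst h hd (by simpa [seval_length] using hlen)

theorem sstep_eq_none {o σ Q} : sstep o σ Q = none ↔ Q = .nil := by
  cases Q <;> simp [sstep]

/-! ### Evaluation is an instance of symbolic evaluation -/

/-- The origins of the actors `As` created in the transition `σ`, where the first one has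
rank `k`. -/
def createdNames (σ : List ℕ) : ℕ → List ActorName → List SName
  | _, [] => []
  | k, A :: As => .act σ k A.cls :: createdNames σ (k + 1) As

theorem origin_of_mem_createdNames {σ k As a} (h : a ∈ createdNames σ k As) : a.origin = σ := by
  induction As generalizing k with
  | nil => simp [createdNames] at h
  | cons A As ih =>
    rcases List.mem_cons.1 h with rfl | h
    · rfl
    · exact ih h

theorem Eval.fresh {used Es Us As} (h : Eval used Es Us As) :
    As.Nodup ∧ ∀ A ∈ As, A ∉ used := by
  induction h with
  | nil => simp
  | value U h ih => exact ih
  | new C k fresh h ih =>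
    refine ⟨List.nodup_cons.2 ⟨fun hm => ih.2 _ hm (Set.mem_insert _ _), ih.1⟩, ?_⟩
    intro A hA
    rcases List.mem_cons.1 hA with rfl | hA
    · exact fresh.1
    · exact fun hu => ih.2 _ hA (Set.mem_insert_of_mem _ hu)

theorem Eval.created {used : Set ActorName} {Es : List (Expr Value)} {Us As}
    (h : Eval used Es Us As) : As.map ActorName.cls = Es.flatMap Expr.created := by
  induction h with
  | nil => rfl
  | value U h ih => simpa [Expr.created] using ih
  | new C k fresh h ih => simpa [Expr.created] using ih

theorem Expr.created_map {α β : Type} (f : α → β) (E : Expr α) :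
    (E.map f).created = E.created := by
  cases E <;> rfl

/-- The interpretation `ν'` agrees with `ν` on names already present and sends the new symbolic
names to the actors actually created. The second conclusion bounds the names that may become live.
-/
theorem Eval.seval {used : Set ActorName} {Es : List (Expr SName)} {Es' Us As ν ν' σ k}
    (h : Eval used Es' Us As) (hEs : Es' = Es.map (Expr.map ν))
    (old : ∀ a ∈ Es.flatMap Expr.names, ν' a = ν a)
    (new : (createdNames σ k As).map ν' = As.map Value.actor) :
    Us = (seval σ k Es).map ν' ∧
      ∀ a ∈ ActorSL.seval σ k Es, a ∈ Es.flatMap Expr.names ∨ a ∈ createdNames σ k As := by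
  induction h generalizing Es k with
  | nil =>
    cases Es with
    | nil => simp [ActorSL.seval]
    | cons E Es => simp at hEs
  | value U h ih =>
    rcases Es with _ | ⟨a | C, Es⟩
    · simp at hEs
    · simp only [List.map_cons, Expr.map, List.cons.injEq, Expr.name.injEq] at hEs
      obtain ⟨rfl, rfl⟩ := hEs
      simp only [List.flatMap_cons, Expr.names, List.mem_append, List.mem_singleton] at old
      obtain ⟨h1, h2⟩ := ih rfl (fun a ha => old a (.inr ha)) new
      refine ⟨?_, ?_⟩
      · simp [ActorSL.seval, ← h1, old a (.inl rfl)]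
      · intro b hb
        simp only [ActorSL.seval, List.mem_cons] at hb
        simp only [List.flatMap_cons, Expr.names, List.mem_append, List.mem_singleton]
        rcases hb with rfl | hb
        · exact .inl (.inl rfl)
        · rcases h2 b hb with h | h
          · exact .inl (.inr h)
          · exact .inr h
    · simp [Expr.map] at hEs
  | new C j fresh h ih =>
    rcases Es with _ | ⟨a | C', Es⟩
    · simp at hEs
    · simp [Expr.map] at hEs
    · simp only [List.map_cons, Expr.map, List.cons.injEq, Expr.new.injEq] at hEs
      obtain ⟨rfl, rfl⟩ := hEs
      simp only [List.flatMap_cons, Expr.names, List.nil_append] at old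
      simp only [createdNames, List.map_cons, List.cons.injEq] at new
      obtain ⟨h1, h2⟩ := ih rfl old new.2
      refine ⟨?_, ?_⟩
      · simp [ActorSL.seval, ← h1, new.1]
      · intro b hb
        simp only [ActorSL.seval, List.mem_cons] at hb
        simp only [List.flatMap_cons, Expr.names, List.nil_append, createdNames, List.mem_cons]
        rcases hb with rfl | hb
        · exact .inr (.inl rfl)
        · rcases h2 b hb with h | h
          · exact .inl h
          · exact .inr (.inr h)

theorem seval_one (σ : List ℕ) (E : Expr SName) : seval σ 0 [E] = [sevalOne σ E] := by
  cases E <;> rfl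

/-! ### Instantiation of method bodies -/

theorem FreshVars.fresh {used n ys} (h : FreshVars used n ys) :
    ys.length = n ∧ ys.Nodup ∧ ∀ y ∈ ys, y ∉ used := by
  induction h with
  | zero => simp
  | succ fresh h ih =>
    refine ⟨by simp [ih.1], List.nodup_cons.2 ⟨fun hm => ih.2.2 _ hm (Set.mem_insert _ _),
      ih.2.1⟩, ?_⟩
    intro y hy
    rcases List.mem_cons.1 hy with rfl | hy
    · exact fresh.1
    · exact fun hu => ih.2.2 _ hy (Set.mem_insert_of_mem _ hu)

theorem lookup_map_snd {α β γ : Type} [BEq α] (x : α) (f : β → γ) (l : List (α × β)) :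
    (l.map (Prod.map id f)).lookup x = (l.lookup x).map f := by
  induction l with
  | nil => rfl
  | cons a l ih =>
    obtain ⟨a, b⟩ := a
    cases h : x == a <;> simp [List.lookup_cons, h, ih]

theorem mem_of_lookup {α β : Type} [BEq α] [LawfulBEq α] {x : α} {b : β} {l : List (α × β)}
    (h : l.lookup x = some b) : (x, b) ∈ l := by
  induction l with
  | nil => simp at h
  | cons a l ih =>
    rw [List.lookup_cons] at h
    split at h
    · rename_i hx
      rw [beq_iff_eq] at hx
      cases h
      simp [hx]
    · exact List.mem_cons_of_mem _ (ih h)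

/-- Both lookups run through the same keys, and the two default values correspond under `ν` by
`hmain`, so the substitutions agree everywhere and not just on the names of the body. -/
theorem MethodDef.inst_eq {d : MethodDef} {A us ys σ} {a : SName} {ν : SName → Value}
    (hA : ν a = .actor A) (hmain : ∀ x, ν (.main x) = .var x)
    (hys : ((List.range d.locals.length).map (SName.fvar σ)).map ν = ys.map Value.var) :
    d.inst A (us.map ν) ys = (d.sinst a us σ).map ν := by
  rw [MethodDef.inst, MethodDef.sinst, Proc.map_map]
  congr 1
  funext x
  cases x with
  | this => exact hA.symm
  | var x =>
    simp only [Function.comp_apply]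
    rw [← hys, List.zip_map_right, List.zip_map_right, ← List.map_append, lookup_map_snd]
    cases List.lookup x _ with
    | none => exact (hmain x).symm
    | some b => rfl

theorem exists_lookup {α β : Type} [BEq α] [LawfulBEq α] {x : α} {l : List α} {l' : List β}
    (hl : l.length = l'.length) (hx : x ∈ l) : ∃ b, (l.zip l').lookup x = some b := by
  induction l generalizing l' with
  | nil => simp at hx
  | cons a l ih =>
    cases l' with
    | nil => simp at hl
    | cons b l' =>
      rw [List.zip_cons_cons, List.lookup_cons]
      split
      · exact ⟨_, rfl⟩
      · rename_i h
        rcases List.mem_cons.1 hx with rfl | hx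
        · simp at h
        · exact ih (by simpa using hl) hx

/-- A name of the body is `this`, a parameter or a local, so the default of the lookup is never
taken. The lengths matter because `zip` truncates. -/
theorem MethodDef.mem_names_sinst {d : MethodDef} {a us σ b}
    (hlen : us.length = d.params.length) (h : b ∈ (d.sinst a us σ).names) :
    b = a ∨ b ∈ us ∨ b ∈ (List.range d.locals.length).map (SName.fvar σ) := by
  rw [MethodDef.sinst, Proc.names_map, List.mem_map] at h
  obtain ⟨x, hx, rfl⟩ := h
  cases x with
  | this => exact .inl rfl
  | var x =>
    right
    simp only [List.lookup_append]
    by_cases hp : x ∈ d.params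
    · obtain ⟨b, hb⟩ := exists_lookup (l' := us) hlen.symm hp
      rw [hb]
      exact .inl (List.of_mem_zip (mem_of_lookup hb)).2
    · have hl : x ∈ d.locals := by
        simp only [MethodDef.locals, List.mem_dedup, List.mem_filterMap]
        exact ⟨_, hx, by simp [hp]⟩
      obtain ⟨b, hb⟩ := exists_lookup
        (l' := (List.range d.locals.length).map (SName.fvar σ)) (by simp) hl
      rw [hb]
      cases hu : (d.params.zip us).lookup x with
      | none => exact .inr (List.of_mem_zip (mem_of_lookup hb)).2
      | some c => exact .inl (List.of_mem_zip (mem_of_lookup hu)).2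

/-! ### A normal form for abstract transitions -/

/-- The first transition of the process of an actor, with decoration `σ`: the actors `As` are
created and the messages `ms` are sent. -/
inductive Move (used : Set ActorName) (σ : List ℕ) :
    Proc Value → Proc Value → List ActorName → List AMsg → Label → Prop
  | internal {P P' As} (h : ProcStep used P P' As) : Move used σ P P' As [] (.silent σ)
  | send {A m Es P Us As} (h : Eval used Es Us As) :
      Move used σ (.send (.actor A) m Es P) P As [⟨⟨m, Us, σ⟩, A⟩] (.send σ m Us A)

/-- `A` proceeds to `σ : P`, the messages `ms` are delivered at `B`, and the actors `As` are
created. -/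
def Config.after (S : Config AMsg) (A : ActorName) (σ : List ℕ) (P : Proc Value) (B : ActorName)
    (ms : List AMsg) (As : List ActorName) : Config AMsg :=
  fun C => if C ∈ As then some ⟨[], .nil, []⟩ else
    (S C).map fun t => ⟨if C = A then σ else t.seq, if C = A then P else t.proc,
      if C = B then t.queue ++ ms else t.queue⟩

theorem ProcStep.fresh {used P P' As} (h : ProcStep used P P' As) :
    As.Nodup ∧ ∀ A ∈ As, A ∉ used := by
  cases h with
  | letIn P h => exact h.fresh
  | eq P Q h => exact h.fresh
  | ne P Q h _ => exact h.fresh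
  | left => simp
  | right => simp

theorem Move.fresh {used σ P P' As ms α} (h : Move used σ P P' As ms α) :
    As.Nodup ∧ ∀ A ∈ As, A ∉ used := by
  cases h with
  | internal h => exact h.fresh
  | send h => exact h.fresh

theorem Move.label_seq {used σ P P' As ms α} (h : Move used σ P P' As ms α) : α.seq = σ := by
  cases h <;> rfl

theorem ProcStep.size_lt {used P P' As} (h : ProcStep used P P' As) : P'.size < P.size := by
  cases h with
  | letIn P h => simp [Proc.size, Proc.subst, Proc.size_map]
  | _ => simp only [Proc.size]; omega

/-- Silent moves, self-delivery and delivery elsewhere become one case, so that later invariants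
need only two. `Config.after` treats process and queue independently and thus allows `B = A`; a
silent move delivers the empty list at `A`. -/
theorem AStepBy.normal_form {p : Program} {A S α S'} (h : AStepBy p A S α S') :
    (∃ σ n P P' q As ms B, S A = some ⟨σ ++ [n], P, q⟩ ∧
      Move S.usedActors (σ ++ [n + 1]) P P' As ms α ∧ (∀ m ∈ ms, m.target.cls = B.cls) ∧
      S B ≠ none ∧ S' = S.after A (σ ++ [n + 1]) P' B ms As) ∨
    (∃ σ' σ m Us A' q d ys, S A = some ⟨σ', .nil, ⟨⟨m, Us, σ⟩, A'⟩ :: q⟩ ∧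
      p.defs A.cls m = some d ∧ Us.length = d.params.length ∧
      FreshVars (S.usedVars p) d.locals.length ys ∧ α = .silent (σ ++ [0]) ∧
      S' = S.set A ⟨σ ++ [0], d.inst A' Us ys, q⟩) := by
  cases h with
  | internal hA hP =>
    refine .inl ⟨_, _, _, _, _, _, [], A, hA, .internal hP, by simp, by simp [hA], ?_⟩
    funext C
    simp only [Config.after, Config.spawn, Config.set, List.append_nil, ite_self]
    split_ifs with h1 h2
    · rfl
    · subst h2; simp [hA]
    · simp
  | invkSelf hcls hA hE =>
    refine .inl ⟨_, _, _, _, _, _, _, A, hA, .send hE, by simp [hcls], by simp [hA], ?_⟩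
    funext C
    simp only [Config.after, Config.spawn, Config.set]
    split_ifs with h1 h2
    · rfl
    · subst h2; simp [hA]
    · simp
  | @invk _ A'' _ _ _ _ _ _ _ _ _ _ _ hne hcls hA hA'' hE =>
    refine .inl ⟨_, _, _, _, _, _, _, A'', hA, .send hE, by simp [hcls], by simp [hA''], ?_⟩
    funext C
    simp only [Config.after, Config.spawn, Config.set]
    split_ifs with h1 h2 h3 h4
    · rfl
    · exact absurd (h2.symm.trans h3) hne
    · subst h2; simp [hA'']
    · subst h4; simp [hA]
    · simp
  | inst hA hd hlen hy => exact .inr ⟨_, _, _, _, _, _, _, _, hA, hd, hlen, hy, rfl, rfl⟩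

theorem AStepBy.exists_label_seq {p : Program} {A S α S'} (h : AStepBy p A S α S') :
    ∃ P q, S' A = some ⟨α.seq, P, q⟩ := by
  rcases h.normal_form with ⟨σ, n, P, P', q, As, ms, B, hA, hm, -, -, rfl⟩ |
    ⟨σ', σ, m, Us, A', q, d, ys, hA, -, -, -, rfl, rfl⟩
  · have : A ∉ As := fun h => hm.fresh.2 _ h (.inl (by simp [hA]))
    simp [Config.after, this, hA, hm.label_seq]
  · simp [Config.set, Label.seq]

/-! ### The concrete semantics refines the abstract one -/

theorem omega_eq_none {S : Config Msg} {A} : Omega S A = none ↔ S A = none := by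
  simp [Omega]

theorem occurs_of_omega {S : Config Msg} {v : Value} (h : (Omega S).Occurs v) :
    S.Occurs v ∨ ∃ A, S A ≠ none ∧ v = .actor A := by
  obtain ⟨A, t, hA, h⟩ := h
  simp only [Omega, Option.map_eq_some_iff] at hA
  obtain ⟨t, hA, rfl⟩ := hA
  rcases h with h | ⟨m, hm, h⟩
  · exact .inl ⟨A, t, hA, .inl h⟩
  · simp only [List.mem_map] at hm
    obtain ⟨m, hm, rfl⟩ := hm
    rcases List.mem_cons.1 h with rfl | h
    · exact .inr ⟨A, by simp [hA], rfl⟩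
    · exact .inl ⟨A, t, hA, .inr ⟨m, hm, h⟩⟩

theorem occurs_omega {S : Config Msg} {v : Value} (h : S.Occurs v) : (Omega S).Occurs v := by
  obtain ⟨A, t, hA, h⟩ := h
  refine ⟨A, _, by simp only [Omega, hA]; rfl, ?_⟩
  rcases h with h | ⟨m, hm, h⟩
  · exact .inl h
  · exact .inr ⟨_, List.mem_map_of_mem hm, List.mem_cons_of_mem _ h⟩

/-- The only names that `Omega` adds are those of actors present in the configuration, which are in
use anyway. Hence both semantics allocate the same fresh names and the labels coincide literally. -/
theorem usedActors_omega (S : Config Msg) : (Omega S).usedActors = S.usedActors := by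
  ext A
  simp only [Config.usedActors, Set.mem_ofPred_eq, ne_eq, omega_eq_none]
  constructor
  · rintro (h | h)
    · exact .inl h
    · rcases occurs_of_omega h with h | ⟨B, hB, e⟩
      · exact .inr h
      · cases e; exact .inl hB
  · rintro (h | h)
    · exact .inl h
    · exact .inr (occurs_omega h)

theorem usedVars_omega (S : Config Msg) (p : Program) :
    (Omega S).usedVars p = S.usedVars p := by
  ext x
  simp only [Config.usedVars, Set.mem_ofPred_eq]
  refine or_congr_right ⟨fun h => ?_, occurs_omega⟩
  rcases occurs_of_omega h with h | ⟨B, hB, e⟩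
  · exact h
  · cases e

theorem omega_set (S : Config Msg) (A : ActorName) (t : Term Msg) :
    Omega (S.set A t) =
      (Omega S).set A ⟨t.seq, t.proc, t.queue.map fun m => ⟨m, A⟩⟩ := by
  funext B
  simp only [Omega, Config.set]
  split_ifs with h
  · subst h; rfl
  · rfl

theorem omega_spawn (S : Config Msg) (As : List ActorName) :
    Omega (S.spawn As) = (Omega S).spawn As := by
  funext B
  simp only [Omega, Config.spawn]
  split_ifs <;> rfl

theorem omega_eq_some {S : Config Msg} {A t} (h : S A = some t) :
    Omega S A = some ⟨t.seq, t.proc, t.queue.map fun m => ⟨m, A⟩⟩ := by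
  simp [Omega, h]

theorem CStepBy.omega {p : Program} {A S α S'} (h : CStepBy p A S α S') :
    AStepBy p A (Omega S) α (Omega S') := by
  cases h with
  | internal hA hP =>
    rw [omega_spawn, omega_set]
    exact .internal (omega_eq_some hA) (by rwa [usedActors_omega])
  | invkSelf hA hE =>
    rw [omega_spawn, omega_set, List.map_append]
    exact .invkSelf rfl (omega_eq_some hA) (by rwa [usedActors_omega])
  | invk hne hA hA' hE =>
    rw [omega_spawn, omega_set, omega_set, List.map_append]
    exact .invk hne rfl (omega_eq_some hA) (omega_eq_some hA') (by rwa [usedActors_omega])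
  | inst hA hd hlen hy =>
    rw [omega_set]
    exact .inst (omega_eq_some hA) hd hlen (by rwa [usedVars_omega])

theorem CStep.omega {p : Program} {S α S'} (h : CStep p S α S') :
    AStep p (Omega S) α (Omega S') :=
  let ⟨A, h⟩ := h
  ⟨A, h.omega⟩

theorem omega_initial (p : Program) : Omega (p.initial Msg) = p.initial AMsg := by
  funext A
  simp only [Omega, Program.initial]
  split_ifs <;> rfl

/-! ### Runs -/

/-- `Run R S₀ l S`: the transitions `l`, given by their labels and targets, lead from `S₀`
to `S`. -/
inductive Run {M : Type} (R : Config M → Label → Config M → Prop) (S₀ : Config M) :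
    List (Label × Config M) → Config M → Prop
  | nil : Run R S₀ [] S₀
  | snoc {l S α S'} (h : Run R S₀ l S) (hR : R S α S') : Run R S₀ (l ++ [(α, S')]) S'

/-- The decorations reached in a run. -/
def done {M : Type} (l : List (Label × Config M)) : List (List ℕ) :=
  [0] :: l.map fun e => e.1.seq

theorem done_snoc {M : Type} (l : List (Label × Config M)) (e : Label × Config M) (σ : List ℕ) :
    σ ∈ done (l ++ [e]) ↔ σ ∈ done l ∨ σ = e.1.seq := by
  simp [done, or_assoc]

theorem Run.mono {M : Type} {R R' : Config M → Label → Config M → Prop} {S₀ l S}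
    (hR : ∀ S α S', R S α S' → R' S α S') (h : Run R S₀ l S) : Run R' S₀ l S := by
  induction h with
  | nil => exact .nil
  | snoc _ h ih => exact ih.snoc (hR _ _ _ h)

theorem Run.reachable {M : Type} {R : Config M → Label → Config M → Prop} {S₀ l S}
    (h : Run R S₀ l S) : Reachable R S₀ S := by
  induction h with
  | nil => exact .refl
  | snoc _ h ih => exact ih.tail ⟨_, h⟩

theorem Reachable.exists_run {M : Type} {R : Config M → Label → Config M → Prop} {S₀ S}
    (h : Reachable R S₀ S) : ∃ l, Run R S₀ l S := by
  induction h with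
  | refl => exact ⟨_, .nil⟩
  | tail _ h ih =>
    obtain ⟨l, hl⟩ := ih
    obtain ⟨α, h⟩ := h
    exact ⟨_, hl.snoc h⟩

theorem run_of_seq {M : Type} {R : Config M → Label → Config M → Prop} (S : ℕ → Config M)
    (α : ℕ → Label) (n : ℕ) (h : ∀ i < n, R (S i) (α i) (S (i + 1))) :
    Run R (S 0) ((List.range n).map fun i => (α i, S (i + 1))) (S n) := by
  induction n with
  | zero => exact .nil
  | succ n ih =>
    rw [List.range_succ, List.map_append]
    exact (ih fun i hi => h i (by omega)).snoc (h n (by omega))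

/-- The configurations of a run. -/
theorem Run.exists_seq {M : Type} {R : Config M → Label → Config M → Prop} {S₀ l S}
    (h : Run R S₀ l S) : ∃ T : ℕ → Config M, T 0 = S₀ ∧ T l.length = S ∧
      ∀ i (hi : i < l.length), Run R S₀ (l.take i) (T i) ∧ R (T i) l[i].1 (T (i + 1)) ∧
        T (i + 1) = l[i].2 := by
  induction h with
  | nil => exact ⟨fun _ => S₀, rfl, rfl, by simp⟩
  | @snoc l S α S' h hR ih =>
    obtain ⟨T, h0, hn, hT⟩ := ih
    refine ⟨fun i => if i ≤ l.length then T i else S', by simp [h0], by simp, ?_⟩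
    intro i hi
    simp only [List.length_append, List.length_singleton] at hi
    rcases Nat.lt_succ_iff_lt_or_eq.1 hi with hi | rfl
    · beta_reduce
      rw [if_pos hi.le, if_pos (Nat.succ_le_of_lt hi), List.getElem_append_left hi,
        List.take_append_of_le_length hi.le]
      exact hT i hi
    · simp [hn, h, hR]

theorem Run.omega {p : Program} {R : Config Msg → Label → Config Msg → Prop}
    {R' : Config AMsg → Label → Config AMsg → Prop} {l S}
    (hR : ∀ S α S', R S α S' → R' (Omega S) α (Omega S')) (h : Run R (p.initial Msg) l S) :
    Run R' (p.initial AMsg) (l.map fun e => (e.1, Omega e.2)) (Omega S) := by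
  induction h with
  | nil => rw [omega_initial]; exact .nil
  | snoc _ h ih => rw [List.map_append]; exact ih.snoc (hR _ _ _ h)

theorem done_omega (l : List (Label × Config Msg)) :
    done (l.map fun e => (e.1, Omega e.2)) = done l := by
  simp [done, Function.comp_def]

/-! ### Decorations are unique -/

/-- `D` holds the decorations used so far. An active decoration has no later sibling in `D` and a
pending message no child, which makes the next label new. Uniqueness of holders preserves this when
some other actor or message advances, and closure under dropping the last entry covers a message
just sent. -/
structure SeqInv (D : List (List ℕ)) (S : Config AMsg) : Prop where
  active : ∀ A t, S A = some t → t.seq ≠ [] → t.seq ∈ D ∧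
    ∀ τ n k, t.seq = τ ++ [n] → n < k → τ ++ [k] ∉ D
  pending : ∀ A t m, S A = some t → m ∈ t.queue → m.seq ∈ D ∧ ∀ k, m.seq ++ [k] ∉ D
  active_inj : ∀ A B t t', S A = some t → S B = some t' → t.seq ≠ [] → t.seq = t'.seq → A = B
  queue_nodup : ∀ A t, S A = some t → (t.queue.map fun m => m.seq).Nodup
  queue_disj : ∀ A B t t' m m', S A = some t → S B = some t' → m ∈ t.queue → m' ∈ t'.queue →
    m.seq = m'.seq → A = B
  closed : ∀ σ k, σ ++ [k] ∈ D → σ = [] ∨ σ ∈ D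

theorem seqInv_initial (p : Program) : SeqInv [[0]] (p.initial AMsg) where
  active A t hA _ := by
    simp only [Program.initial, Option.ite_none_right_eq_some, Option.some.injEq] at hA
    obtain ⟨-, rfl⟩ := hA
    refine ⟨by simp, fun τ n k h hk hm => ?_⟩
    obtain ⟨rfl, rfl⟩ := snoc_inj (s := []).1 h
    have := (snoc_inj (t := []).1 (List.mem_singleton.1 hm)).2
    omega
  pending A t m hA hm := by
    simp only [Program.initial, Option.ite_none_right_eq_some, Option.some.injEq] at hA
    obtain ⟨-, rfl⟩ := hA
    simp at hm
  active_inj A B t t' hA hB _ _ := by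
    simp only [Program.initial, Option.ite_none_right_eq_some, Option.some.injEq] at hA hB
    exact hA.1.trans hB.1.symm
  queue_nodup A t hA := by
    simp only [Program.initial, Option.ite_none_right_eq_some, Option.some.injEq] at hA
    obtain ⟨-, rfl⟩ := hA
    simp
  queue_disj A B t t' m m' hA hB hm hm' _ := by
    simp only [Program.initial, Option.ite_none_right_eq_some, Option.some.injEq] at hA
    obtain ⟨-, rfl⟩ := hA
    simp at hm
  closed σ k h := .inl (snoc_inj (t := []).1 (List.mem_singleton.1 h)).1

theorem Config.after_eq_some {S : Config AMsg} {A σ P B ms As C t'}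
    (h : S.after A σ P B ms As C = some t') :
    (C ∈ As ∧ t' = ⟨[], .nil, []⟩) ∨ (C ∉ As ∧ ∃ t, S C = some t ∧
      t' = ⟨if C = A then σ else t.seq, if C = A then P else t.proc,
        if C = B then t.queue ++ ms else t.queue⟩) := by
  simp only [Config.after] at h
  by_cases hC : C ∈ As
  · rw [if_pos hC] at h
    exact .inl ⟨hC, (Option.some.inj h).symm⟩
  · rw [if_neg hC] at h
    obtain ⟨t, ht, rfl⟩ := Option.map_eq_some_iff.1 h
    exact .inr ⟨hC, t, ht, rfl⟩

theorem Config.set_eq_some {M : Type} {S : Config M} {A t C t'} (h : S.set A t C = some t') :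
    (C = A ∧ t' = t) ∨ (C ≠ A ∧ S C = some t') := by
  simp only [Config.set] at h
  split_ifs at h with hC
  · exact .inl ⟨hC, (Option.some.inj h).symm⟩
  · exact .inr ⟨hC, h⟩

theorem Move.messages {used σ P P' As ms α} (h : Move used σ P P' As ms α) :
    ms = [] ∨ ∃ m : AMsg, ms = [m] ∧ m.seq = σ := by
  cases h with
  | internal => exact .inl rfl
  | send => exact .inr ⟨_, rfl, rfl⟩

theorem SeqInv.fresh {p : Program} {D S A α S'} (inv : SeqInv D S) (h : AStepBy p A S α S') :
    α.seq ∉ D := by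
  rcases h.normal_form with ⟨σ, n, P, P', q, As, ms, B, hA, hm, -, -, -⟩ |
    ⟨σ', σ, m, Us, A', q, d, ys, hA, -, -, -, rfl, -⟩
  · rw [hm.label_seq]
    exact (inv.active _ _ hA (by simp)).2 _ _ _ rfl (by omega)
  · exact (inv.pending _ _ _ hA List.mem_cons_self).2 0

theorem SeqInv.step {p : Program} {D D' S A α S'} (inv : SeqInv D S) (h : AStepBy p A S α S')
    (hD : ∀ σ, σ ∈ D' ↔ σ ∈ D ∨ σ = α.seq) : SeqInv D' S' := by
  have fresh := inv.fresh h
  rcases h.normal_form with ⟨σ, n, P, P', q, As, ms, B, hA, hm, -, -, rfl⟩ |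
    ⟨σ', σ, m, Us, A', q, d, ys, hA, -, -, -, rfl, rfl⟩
  · rw [hm.label_seq] at hD fresh
    have hAD := inv.active _ _ hA (by simp)
    have hq : ∀ C t m, S C = some t → m ∈ (if C = B then t.queue ++ ms else t.queue) →
        m ∈ t.queue ∨ (C = B ∧ m.seq = σ ++ [n + 1]) := by
      intro C t m hC h
      split_ifs at h with hCB
      · rcases List.mem_append.1 h with h | h
        · exact .inl h
        · rcases hm.messages with rfl | ⟨m', rfl, hm'⟩
          · simp at h
          · rw [List.mem_singleton] at h
            exact .inr ⟨hCB, h ▸ hm'⟩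
      · exact .inl h
    constructor
    · intro C t' hC hne
      rcases Config.after_eq_some hC with ⟨-, rfl⟩ | ⟨-, t, ht, rfl⟩
      · simp at hne
      · by_cases hCA : C = A
        · simp only [hCA, if_true] at hne ⊢
          refine ⟨(hD _).2 (.inr rfl), fun τ i k h hk hm => ?_⟩
          obtain ⟨rfl, rfl⟩ := snoc_inj.1 h
          rcases (hD _).1 hm with hm | hm
          · exact hAD.2 _ _ _ rfl (by omega) hm
          · have := (snoc_inj.1 hm).2; omega
        · simp only [hCA, if_false] at hne ⊢
          have hCD := inv.active _ _ ht hne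
          refine ⟨(hD _).2 (.inl hCD.1), fun τ i k hs hk hm => ?_⟩
          rcases (hD _).1 hm with hm | hm
          · exact hCD.2 _ _ _ hs hk hm
          · obtain ⟨rfl, rfl⟩ := snoc_inj.1 hm
            -- The new decoration is a later sibling of that of `C`. Either the old decoration of
            -- `A` already was one, or `C` and `A` held the same decoration.
            rcases Nat.lt_or_ge i n with hi | hi
            · exact hCD.2 _ _ _ hs hi hAD.1
            · obtain rfl : i = n := by omega
              exact hCA (inv.active_inj _ _ _ _ ht hA hne hs)
    · intro C t' m hC hmq
      rcases Config.after_eq_some hC with ⟨-, rfl⟩ | ⟨-, t, ht, rfl⟩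
      · simp at hmq
      · rcases hq C t m ht hmq with h | ⟨-, h⟩
        · have hmD := inv.pending _ _ _ ht h
          refine ⟨(hD _).2 (.inl hmD.1), fun k hk => ?_⟩
          rcases (hD _).1 hk with hk | hk
          · exact hmD.2 _ hk
          · rw [(snoc_inj.1 hk).1] at hmD
            exact hmD.2 _ hAD.1
        · rw [h]
          refine ⟨(hD _).2 (.inr rfl), fun k hk => ?_⟩
          rcases (hD _).1 hk with hk | hk
          -- A child in `D` of the decoration of the new message would put that decoration itself
          -- into `D`.
          · rcases inv.closed _ _ hk with h | h
            · simp at h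
            · exact fresh h
          · simp at hk
    · intro C C' t' t'' hC hC' hne he
      rcases Config.after_eq_some hC with ⟨-, rfl⟩ | ⟨-, t, ht, rfl⟩
      · simp at hne
      rcases Config.after_eq_some hC' with ⟨-, rfl⟩ | ⟨-, t1, ht1, rfl⟩
      · exact absurd he hne
      by_cases hCA : C = A <;> by_cases hCA' : C' = A
      · rw [hCA, hCA']
      · simp only [hCA, hCA', if_true, if_false] at he hne
        exact absurd (he ▸ (inv.active _ _ ht1 (he ▸ hne)).1) fresh
      · simp only [hCA, hCA', if_true, if_false] at he hne
        exact absurd (he ▸ (inv.active _ _ ht hne).1) fresh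
      · simp only [hCA, hCA', if_false] at he hne
        exact inv.active_inj _ _ _ _ ht ht1 hne he
    · intro C t' hC
      rcases Config.after_eq_some hC with ⟨-, rfl⟩ | ⟨-, t, ht, rfl⟩
      · simp
      · dsimp only
        split_ifs
        · rcases hm.messages with rfl | ⟨m', rfl, hm'⟩
          · simpa using inv.queue_nodup _ _ ht
          · rw [List.map_append, List.nodup_append]
            refine ⟨inv.queue_nodup _ _ ht, by simp, ?_⟩
            simp only [List.mem_map, List.map_cons, List.map_nil, List.mem_singleton]
            rintro _ ⟨m, hmq, rfl⟩ _ rfl e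
            rw [hm'] at e
            exact fresh (e ▸ (inv.pending _ _ _ ht hmq).1)
        · exact inv.queue_nodup _ _ ht
    · intro C C' t' t'' m m' hC hC' hmq hmq' he
      rcases Config.after_eq_some hC with ⟨-, rfl⟩ | ⟨-, t, ht, rfl⟩
      · simp at hmq
      rcases Config.after_eq_some hC' with ⟨-, rfl⟩ | ⟨-, t1, ht1, rfl⟩
      · simp at hmq'
      rcases hq C t m ht hmq with h | ⟨h1, h⟩ <;> rcases hq C' t1 m' ht1 hmq' with h' | ⟨h1', h'⟩
      · exact inv.queue_disj _ _ _ _ _ _ ht ht1 h h' he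
      · exact absurd (h' ▸ he ▸ (inv.pending _ _ _ ht h).1) fresh
      · exact absurd (h ▸ he ▸ (inv.pending _ _ _ ht1 h').1) fresh
      · rw [h1, h1']
    · intro τ k h
      rcases (hD _).1 h with h | h
      · exact (inv.closed _ _ h).imp_right fun h => (hD _).2 (.inl h)
      · rw [(snoc_inj.1 h).1]
        rcases List.eq_nil_or_concat σ with rfl | ⟨τ', j, rfl⟩
        · exact .inl rfl
        · exact (inv.closed _ _ hAD.1).imp_right fun h => (hD _).2 (.inl h)
  · have hAm := inv.pending _ _ _ hA List.mem_cons_self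
    have hnd := inv.queue_nodup _ _ hA
    simp only [List.map_cons, List.nodup_cons] at hnd
    simp only [Label.seq] at hD fresh
    have hq : ∀ C t, S.set A ⟨σ ++ [0], d.inst A' Us ys, q⟩ C = some t →
        ∃ t', S C = some t' ∧ ∀ m ∈ t.queue, m ∈ t'.queue ∧ m.seq ≠ σ := by
      intro C t hC
      rcases Config.set_eq_some hC with ⟨rfl, rfl⟩ | ⟨hCA, hC⟩
      · refine ⟨_, hA, fun m hm => ⟨List.mem_cons_of_mem _ hm, fun e => hnd.1 ?_⟩⟩
        rw [← e]
        exact List.mem_map_of_mem (f := fun m : AMsg => m.seq) hm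
      · exact ⟨t, hC, fun m hm => ⟨hm, fun e =>
          hCA (inv.queue_disj _ _ _ _ _ _ hC hA hm List.mem_cons_self e)⟩⟩
    constructor
    · intro C t' hC hne
      rcases Config.set_eq_some hC with ⟨rfl, rfl⟩ | ⟨hCA, hC⟩
      · refine ⟨(hD _).2 (.inr rfl), fun τ i k h hk hm => ?_⟩
        obtain ⟨rfl, rfl⟩ := snoc_inj.1 h
        rcases (hD _).1 hm with hm | hm
        · exact hAm.2 _ hm
        · have := (snoc_inj.1 hm).2; omega
      · have hCD := inv.active _ _ hC hne
        refine ⟨(hD _).2 (.inl hCD.1), fun τ i k h hk hm => ?_⟩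
        rcases (hD _).1 hm with hm | hm
        · exact hCD.2 _ _ _ h hk hm
        · have := (snoc_inj.1 hm).2; omega
    · intro C t' m' hC hmq
      obtain ⟨t, ht, h⟩ := hq C t' hC
      obtain ⟨h, hne⟩ := h m' hmq
      have hmD := inv.pending _ _ _ ht h
      refine ⟨(hD _).2 (.inl hmD.1), fun k hk => ?_⟩
      rcases (hD _).1 hk with hk | hk
      · exact hmD.2 _ hk
      · exact hne (snoc_inj.1 hk).1
    · intro C C' t t' hC hC' hne he
      rcases Config.set_eq_some hC with ⟨rfl, rfl⟩ | ⟨hCA, hC1⟩ <;>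
        rcases Config.set_eq_some hC' with ⟨rfl, rfl⟩ | ⟨hCA', hC1'⟩
      · rfl
      · dsimp only at he hne
        exact absurd (he ▸ (inv.active _ _ hC1' (he ▸ hne)).1) fresh
      · dsimp only at he
        exact absurd (he ▸ (inv.active _ _ hC1 hne).1) fresh
      · exact inv.active_inj _ _ _ _ hC1 hC1' hne he
    · intro C t hC
      rcases Config.set_eq_some hC with ⟨rfl, rfl⟩ | ⟨hCA, hC⟩
      · exact hnd.2
      · exact inv.queue_nodup _ _ hC
    · intro C C' t t' m m' hC hC' hmq hmq' he
      obtain ⟨t1, ht1, h1⟩ := hq C t hC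
      obtain ⟨t2, ht2, h2⟩ := hq C' t' hC'
      exact inv.queue_disj _ _ _ _ _ _ ht1 ht2 (h1 m hmq).1 (h2 m' hmq').1 he
    · intro τ k h
      rcases (hD _).1 h with h | h
      · exact (inv.closed _ _ h).imp_right fun h => (hD _).2 (.inl h)
      · rw [(snoc_inj.1 h).1]
        exact .inr ((hD _).2 (.inl hAm.1))

theorem Run.seqInv {p : Program} {l S} (h : Run (AStep p) (p.initial AMsg) l S) :
    SeqInv (done l) S := by
  induction h with
  | nil => exact seqInv_initial p
  | snoc _ h ih =>
    obtain ⟨A, h⟩ := h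
    exact ih.step h (done_snoc _ _)

/-! ### Abstract runs are instances of the symbolic execution -/

/-- If the actor `A` makes a choice, then it follows `o`. -/
def Follows {M : Type} (o : List ℕ → Bool) (A : ActorName) (S : Config M) (α : Label)
    (S' : Config M) : Prop :=
  ∀ t t' P Q, S A = some t → S' A = some t' → t.proc = .choice P Q →
    t'.proc = if o α.seq then P else Q

def AStepFollowing (p : Program) (o : List ℕ → Bool) (S : Config AMsg) (α : Label)
    (S' : Config AMsg) : Prop :=
  ∃ A, AStepBy p A S α S' ∧ Follows o A S α S'

/-- `ν` respects the kinds of names. -/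
structure Interp (p : Program) (ν : SName → Value) : Prop where
  main : ∀ x, ν (.main x) = .var x
  fvar : ∀ σ k, ∃ y, y ∉ p.main.names ∧ ν (.fvar σ k) = .var y
  act : ∀ σ k C, ∃ A : ActorName, A.cls = C ∧ ν (.act σ k C) = .actor A

theorem Interp.kindPreserving {p : Program} {ν ν'} (h : Interp p ν) (h' : Interp p ν')
    (a : SName) : KindPreserving p (ν a) (ν' a) := by
  cases a with
  | main x => rw [h.main, h'.main]; exact .refl p _
  | fvar σ k =>
    obtain ⟨y, hy, e⟩ := h.fvar σ k
    obtain ⟨y', hy', e'⟩ := h'.fvar σ k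
    rw [e, e']
    refine ⟨fun x hx hx' => ?_, fun _ _ _ => ⟨y', hy', rfl⟩, fun A hA => by cases hA⟩
    cases hx
    exact absurd hx' hy
  | act σ k C =>
    obtain ⟨A, hA, e⟩ := h.act σ k C
    obtain ⟨A', hA', e'⟩ := h'.act σ k C
    rw [e, e']
    refine ⟨fun x hx => (by cases hx), fun x hx => (by cases hx), fun B hB => ?_⟩
    cases hB
    exact ⟨A', hA'.trans hA.symm, rfl⟩

theorem exists_interp (p : Program) : ∃ ν, Interp p ν := by
  obtain ⟨y, hy, -⟩ := exists_var_notMem [] p.main.names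
  exact ⟨fun a => match a with
    | .main x => .var x
    | .fvar _ _ => .var y
    | .act _ _ C => .actor ⟨C, 0⟩, fun _ => rfl, fun _ _ => ⟨y, hy, rfl⟩, fun _ _ _ => ⟨_, rfl, rfl⟩⟩

theorem createdNames_map {σ k As} {ν : SName → Value}
    (h : ∀ j A, As[j]? = some A → ν (.act σ (k + j) A.cls) = .actor A) :
    (createdNames σ k As).map ν = As.map Value.actor := by
  induction As generalizing k with
  | nil => rfl
  | cons A As ih =>
    simp only [createdNames, List.map_cons]
    have h0 := h 0 A rfl
    rw [Nat.add_zero] at h0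
    rw [ih, h0]
    intro j B hB
    rw [← h (j + 1) B hB, Nat.add_right_comm, Nat.add_assoc]

/-- Only names with origin `σ` are reinterpreted. At ranks out of range or with the wrong class `ν`
is kept, so that kinds are respected everywhere. -/
theorem Interp.extend_act {p : Program} {ν} (h : Interp p ν) (σ : List ℕ) (As : List ActorName) :
    ∃ ν', Interp p ν' ∧ (∀ a, a.origin ≠ σ → ν' a = ν a) ∧
      (createdNames σ 0 As).map ν' = As.map Value.actor := by
  classical
  refine ⟨fun a => match a with
    | .act τ k C => if τ = σ then
        match As[k]? with
        | some A => if A.cls = C then .actor A else ν (.act τ k C)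
        | none => ν (.act τ k C)
      else ν (.act τ k C)
    | a => ν a, ⟨h.main, h.fvar, ?_⟩, ?_, ?_⟩
  · intro τ k C
    dsimp only
    split_ifs
    · split
      · split_ifs with hC
        · exact ⟨_, hC, rfl⟩
        · exact h.act _ _ _
      · exact h.act _ _ _
    · exact h.act _ _ _
  · rintro (_ | _ | ⟨τ, k, C⟩) ha
    · rfl
    · rfl
    · exact if_neg ha
  · refine createdNames_map fun j A hA => ?_
    simp [hA]

theorem Interp.extend_fvar {p : Program} {ν} (h : Interp p ν) (σ : List ℕ) (ys : List Var)
    (hys : ∀ y ∈ ys, y ∉ p.main.names) :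
    ∃ ν', Interp p ν' ∧ (∀ a, a.origin ≠ σ → ν' a = ν a) ∧
      ((List.range ys.length).map (SName.fvar σ)).map ν' = ys.map Value.var := by
  classical
  refine ⟨fun a => match a with
    | .fvar τ k => if τ = σ then
        match ys[k]? with
        | some y => .var y
        | none => ν (.fvar τ k)
      else ν (.fvar τ k)
    | a => ν a, ⟨h.main, ?_, h.act⟩, ?_, ?_⟩
  · intro τ k
    dsimp only
    split_ifs
    · split
      · rename_i y hy
        exact ⟨_, hys _ (List.mem_of_getElem? hy), rfl⟩
      · exact h.fvar _ _
    · exact h.fvar _ _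
  · rintro (_ | ⟨τ, k⟩ | _) ha
    · rfl
    · exact if_neg ha
    · rfl
  · refine List.ext_getElem (by simp) fun j h1 h2 => ?_
    have : j < ys.length := by simpa using h1
    simp [this]

/-- Pairwise distinct values avoiding the old ones preserve injectivity; `L` will be instantiated
with liveness before the transition. -/
theorem injOn_extend {ν ν' : SName → Value} {L : SName → Prop} {new : List SName}
    {vals : List Value} (hnew : new.map ν' = vals) (hnd : vals.Nodup)
    (old : ∀ a, L a → ν' a = ν a) (inj : ∀ a b, L a → L b → ν a = ν b → a = b)
    (fresh : ∀ a, L a → ν a ∉ vals) :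
    ∀ a b, (L a ∨ a ∈ new) → (L b ∨ b ∈ new) → ν' a = ν' b → a = b := by
  subst hnew
  rintro a b (ha | ha) (hb | hb) e
  · rw [old a ha, old b hb] at e
    exact inj a b ha hb e
  · rw [old a ha] at e
    exact absurd (e ▸ List.mem_map_of_mem hb) (fresh a ha)
  · rw [old b hb] at e
    exact absurd (e ▸ List.mem_map_of_mem ha) (fresh b hb)
  · exact List.inj_on_of_nodup_map hnd ha hb e

/-- The heart of the argument: a move of an instance of `Q` is an instance of the symbolic step of
`Q`. Substitution commutes with interpretation, the hypothesis `choice` supplies agreement with the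
oracle, and injectivity settles tests. -/
theorem Move.symbolic {p : Program} {o used σ Q P' As ms α ν ν'} (hν : Interp p ν)
    (hm : Move used σ (Proc.map Q ν) P' As ms α)
    (old : ∀ a ∈ Q.names, ν' a = ν a)
    (new : (createdNames σ 0 As).map ν' = As.map Value.actor)
    (inj : ∀ a b, (a ∈ Q.names ∨ a ∈ createdNames σ 0 As) →
      (b ∈ Q.names ∨ b ∈ createdNames σ 0 As) → ν' a = ν' b → a = b)
    (choice : ∀ Q₁ Q₂, Q = .choice Q₁ Q₂ → P' = (if o σ then Q₁ else Q₂).map ν) :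
    (∃ Q', sstep o σ Q = some Q' ∧ P' = Q'.map ν' ∧
      ∀ a ∈ Q'.names, a ∈ Q.names ∨ a ∈ createdNames σ 0 As) ∧
    As.map ActorName.cls = Q.headCreated ∧
    ((ms = [] ∧ α = .silent σ ∧ ∀ x m Es P, Q ≠ .send x m Es P) ∨
      ∃ τ k C m Es P A, Q = .send (.act τ k C) m Es P ∧ ν (.act τ k C) = .actor A ∧ A.cls = C ∧
        ms = [⟨⟨m, (seval σ 0 Es).map ν', σ⟩, A⟩] ∧
        α = .send σ m ((seval σ 0 Es).map ν') A ∧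
        ∀ a ∈ seval σ 0 Es, a ∈ Q.names ∨ a ∈ createdNames σ 0 As) := by
  cases Q with
  | nil => simp only [Proc.map] at hm; nomatch hm
  | letIn E P =>
    simp only [Proc.map] at hm
    rcases hm with ⟨⟨_, h⟩⟩
    simp only [Proc.names, List.mem_append] at old ⊢
    obtain ⟨h1, h2⟩ := h.seval (Es := [E]) rfl (fun a ha => old a (.inl (by simpa using ha))) new
    rw [seval_one] at h1 h2
    simp only [List.map_cons, List.map_nil, List.cons.injEq, and_true] at h1
    subst h1
    refine ⟨⟨_, rfl, ?_, ?_⟩, ?_, .inl ⟨trivial, trivial, by simp⟩⟩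
    · rw [Proc.map_subst]
      congr 1
      refine Proc.map_congr _ ?_
      rintro (_ | a) ha
      · rfl
      · simp [old a (.inr (List.reduceOption_mem_iff.2 ha))]
    · intro a ha
      rcases Proc.mem_names_subst ha with rfl | ha
      · rcases h2 _ (List.mem_singleton.2 rfl) with h | h
        · exact .inl (.inl (by simpa using h))
        · exact .inr h
      · exact .inl (.inr ha)
    · simpa [Proc.headCreated, Expr.created_map] using h.created
  | send x m Es P =>
    simp only [Proc.map] at hm
    generalize hx : ν x = v at hm
    rcases hm with ⟨⟨⟩⟩ | ⟨h⟩
    rename_i A Us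
    simp only [Proc.names, List.mem_append, List.mem_cons] at old ⊢
    obtain ⟨rfl, h2⟩ := h.seval rfl (fun a ha => old a (.inr (.inl ha))) new
    refine ⟨⟨_, rfl, Proc.map_congr _ fun a ha => (old a (.inr (.inr ha))).symm,
      fun a ha => .inl (.inr (.inr ha))⟩, ?_, .inr ?_⟩
    · have := h.created
      simpa [Proc.headCreated, List.flatMap_map, Expr.created_map] using this
    · cases x with
      -- A name interpreted by a variable cannot be the target of a send, so the target was
      -- allocated as an actor and its origin records its class.
      | main x => rw [hν.main] at hx; cases hx
      | fvar τ k =>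
        obtain ⟨y, -, hy⟩ := hν.fvar τ k
        rw [hy] at hx
        cases hx
      | act τ k C =>
        obtain ⟨B, hB, hy⟩ := hν.act τ k C
        rw [hy] at hx
        cases hx
        refine ⟨τ, k, C, m, Es, P, _, rfl, hy, hB, rfl, rfl, fun a ha => ?_⟩
        rcases h2 a ha with h | h
        · exact .inl (.inr (.inl h))
        · exact .inr h
  | cond E E' P Q =>
    simp only [Proc.map] at hm
    simp only [Proc.names, List.mem_append] at old inj ⊢
    -- The test on values and the test on origins have the same outcome: the old and newly created
    -- names are interpreted injectively.
    have key : ∀ U V, Eval used [E.map ν, E'.map ν] [U, V] As →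
        As.map ActorName.cls = E.created ++ E'.created ∧
        (U = V ↔ ∃ u, seval σ 0 [E, E'] = [u, u]) := by
      intro U V h
      obtain ⟨h1, h2⟩ := h.seval (Es := [E, E']) rfl
        (fun a ha => old a (.inl (.inl (by simpa using ha)))) new
      refine ⟨by simpa [Expr.created_map] using h.created, ?_⟩
      obtain ⟨u, v, huv⟩ : ∃ u v, seval σ 0 [E, E'] = [u, v] := by
        cases E <;> cases E' <;> exact ⟨_, _, rfl⟩
      rw [huv] at h1 h2 ⊢
      simp only [List.map_cons, List.map_nil, List.cons.injEq, and_true] at h1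
      obtain ⟨rfl, rfl⟩ := h1
      constructor
      · intro e
        refine ⟨u, ?_⟩
        have hmem : ∀ a ∈ [u, v], (((a ∈ E.names ∨ a ∈ E'.names) ∨ a ∈ P.names) ∨ a ∈ Q.names) ∨
            a ∈ createdNames σ 0 As := by
          intro a ha
          rcases h2 a ha with h | h
          · simp only [List.flatMap_cons, List.flatMap_nil, List.append_nil,
              List.mem_append] at h
            exact .inl (.inl (.inl h))
          · exact .inr h
        rw [inj u v (hmem u (by simp)) (hmem v (by simp)) e]
      · rintro ⟨w, hw⟩
        simp only [List.cons.injEq, and_true] at hw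
        rw [hw.1, hw.2]
    rcases hm with ⟨_ | ⟨_, _, h⟩ | ⟨_, _, h, hne⟩⟩
    · obtain ⟨hc, he⟩ := key _ _ h
      refine ⟨⟨P, ?_, Proc.map_congr _ fun a ha => (old a (.inl (.inr ha))).symm,
        fun a ha => .inl (.inl (.inr ha))⟩, hc, .inl ⟨rfl, rfl, by simp⟩⟩
      simp only [sstep]
      rw [if_pos (he.1 rfl)]
    · obtain ⟨hc, he⟩ := key _ _ h
      refine ⟨⟨Q, ?_, Proc.map_congr _ fun a ha => (old a (.inr ha)).symm,
        fun a ha => .inl (.inr ha)⟩, hc, .inl ⟨rfl, rfl, by simp⟩⟩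
      simp only [sstep]
      rw [if_neg fun h => hne (he.2 h)]
  | choice P Q =>
    simp only [Proc.map] at hm
    simp only [Proc.names, List.mem_append] at old ⊢
    have hP' := choice P Q rfl
    have hAs : As = [] ∧ ms = [] ∧ α = .silent σ := by
      rcases hm with ⟨_ | _ | _ | _ | _⟩ <;> exact ⟨rfl, rfl, rfl⟩
    obtain ⟨rfl, rfl, rfl⟩ := hAs
    refine ⟨⟨_, rfl, ?_, ?_⟩, rfl, .inl ⟨rfl, rfl, by simp⟩⟩
    · rw [hP']
      refine Proc.map_congr _ fun a ha => (old a ?_).symm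
      split_ifs at ha
      · exact .inl ha
      · exact .inr ha
    · intro a ha
      split_ifs at ha
      · exact .inl (.inl ha)
      · exact .inl (.inr ha)

/-- The symbolic names that occur in a configuration. -/
def Live (p : Program) (o : List ℕ → Bool) (S : Config AMsg) (a : SName) : Prop :=
  (∃ A t c Q, S A = some t ∧ Tree p o t.seq c Q ∧ a ∈ Q.names) ∨
  (∃ A t m C M, S A = some t ∧ m ∈ t.queue ∧ TMsg p o m.seq C M ∧ a ∈ M.names)

/-- The configuration `S`, reached by transitions with decorations in `D`, is an instance of the
symbolic execution under the interpretation `ν`. -/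
structure SymInv (p : Program) (o : List ℕ → Bool) (D : List (List ℕ)) (S : Config AMsg)
    (ν : SName → Value) : Prop where
  interp : Interp p ν
  idle : ∀ A t, S A = some t → t.seq = [] → t.proc = .nil ∧ ∃ σ ∈ D, Creates p o σ A.cls
  proc : ∀ A t, S A = some t → t.seq ≠ [] → ∃ Q, Tree p o t.seq A.cls Q ∧ t.proc = Q.map ν
  msg : ∀ A t m, S A = some t → m ∈ t.queue → ∃ M, TMsg p o m.seq A.cls M ∧ m.meth = M.meth ∧
    m.args = M.args.map ν ∧ ν M.target = .actor m.target
  -- Injectivity is limited to live names: a variable that has left the configuration may be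
  -- allocated again.
  inj : ∀ a b, Live p o S a → Live p o S b → ν a = ν b → a = b
  origin : ∀ a, Live p o S a → a.origin = [] ∨ a.origin ∈ D
  -- The last three clauses say that nothing is lost: a node reached has continued, has terminated
  -- or is still held by an actor; a message sent has been served or is queued; an actor created
  -- exists.
  continues : ∀ τ n c Q, Tree p o (τ ++ [n]) c Q → τ ++ [n] ∈ D →
    τ ++ [n + 1] ∈ D ∨ Q = .nil ∨ ∃ A t, S A = some t ∧ t.seq = τ ++ [n]
  delivered : ∀ σ C M, TMsg p o σ C M → σ ∈ D →
    σ ++ [0] ∈ D ∨ ∃ A t m, S A = some t ∧ m ∈ t.queue ∧ m.seq = σ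
  creates : ∀ σ C, σ ∈ D → Creates p o σ C → ∃ A, S A ≠ none ∧ A.cls = C

/-- The label `α` is an instance of the symbolic execution. -/
def LabelSpec (p : Program) (o : List ℕ → Bool) (ν : SName → Value) (α : Label) : Prop :=
  ((∃ σ, α = .silent σ) ∧ ∀ C M, ¬ TMsg p o α.seq C M) ∨
  ∃ σ M A, α = .send σ M.meth (M.args.map ν) A ∧ TMsg p o σ A.cls M ∧
    ∀ a ∈ M.args, ∀ b ∈ M.args, ν a = ν b → a = b

/-! ### Preservation of the symbolic invariant along runs. -/

theorem Tree.not_tMsg_zero {p : Program} {o σ C M} : ¬ TMsg p o (σ ++ [0]) C M := by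
  intro h
  generalize hτ : σ ++ [0] = τ at h
  cases h with
  | mk h =>
    have := (snoc_inj.1 hτ).2
    omega

theorem not_creates_zero {p : Program} {o σ C} : ¬ Creates p o (σ ++ [0]) C := by
  rintro ⟨τ, n, c, Q, h, -⟩
  have := (snoc_inj.1 h).2
  omega

theorem symInv_initial (p : Program) (o : List ℕ → Bool) :
    ∃ ν, SymInv p o [[0]] (p.initial AMsg) ν := by
  obtain ⟨ν, hν⟩ := exists_interp p
  have init : ∀ A t, p.initial AMsg A = some t → A = p.root ∧
      t = ⟨[0], p.main.map Value.var, []⟩ := by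
    intro A t h
    simp only [Program.initial, Option.ite_none_right_eq_some, Option.some.injEq] at h
    exact ⟨h.1, h.2.symm⟩
  have live : ∀ a, Live p o (p.initial AMsg) a → ∃ x, a = .main x := by
    rintro a (⟨A, t, c, Q, hA, hQ, ha⟩ | ⟨A, t, m, C, M, hA, hm, -⟩)
    · obtain ⟨-, rfl⟩ := init A t hA
      obtain ⟨-, rfl⟩ := hQ.unique .root
      rw [Proc.names_map, List.mem_map] at ha
      obtain ⟨x, -, rfl⟩ := ha
      exact ⟨x, rfl⟩
    · obtain ⟨-, rfl⟩ := init A t hA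
      simp at hm
  refine ⟨ν, hν, ?_, ?_, ?_, ?_, ?_, ?_, ?_, ?_⟩
  · intro A t hA h
    obtain ⟨-, rfl⟩ := init A t hA
    simp at h
  · intro A t hA h
    obtain ⟨rfl, rfl⟩ := init A t hA
    refine ⟨_, .root, ?_⟩
    rw [Proc.map_map]
    exact Proc.map_congr _ fun x _ => (hν.main x).symm
  · intro A t m hA hm
    obtain ⟨-, rfl⟩ := init A t hA
    simp at hm
  · intro a b ha hb e
    obtain ⟨x, rfl⟩ := live a ha
    obtain ⟨y, rfl⟩ := live b hb
    rw [hν.main, hν.main] at e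
    cases e
    rfl
  · intro a ha
    obtain ⟨x, rfl⟩ := live a ha
    exact .inl rfl
  · intro τ n c Q _ h
    exact .inr (.inr ⟨p.root, _, if_pos rfl, (List.mem_singleton.1 h).symm⟩)
  · intro σ C M h hσ
    rw [List.mem_singleton.1 hσ] at h
    exact absurd h (Tree.not_tMsg_zero (σ := []))
  · intro σ C hσ h
    rw [List.mem_singleton.1 hσ] at h
    exact absurd h (not_creates_zero (σ := []))

/-- This is what separates newly allocated values, which are unused, from the interpretations of
live names. -/
theorem SymInv.occurs {p : Program} {o D S ν a} (inv : SymInv p o D S ν) (h : Live p o S a) :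
    S.Occurs (ν a) := by
  rcases h with ⟨A, t, c, Q, hA, hQ, ha⟩ | ⟨A, t, m, C, M, hA, hm, hM, ha⟩
  · obtain ⟨Q', hQ', e⟩ := inv.proc A t hA hQ.ne_nil
    obtain ⟨-, rfl⟩ := hQ.unique hQ'
    refine ⟨A, t, hA, .inl ?_⟩
    rw [e, Proc.names_map]
    exact List.mem_map_of_mem ha
  · obtain ⟨M', hM', -, e2, e3⟩ := inv.msg A t m hA hm
    obtain ⟨-, rfl⟩ := hM.unique hM'
    refine ⟨A, t, hA, .inr ⟨m, hm, ?_⟩⟩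
    rcases List.mem_cons.1 ha with rfl | ha
    · rw [e3]
      exact List.mem_cons_self
    · refine List.mem_cons_of_mem _ ?_
      rw [e2]
      exact List.mem_map_of_mem ha

/-- Live names originate in `D` or in the main process, while the new decoration is not in `D`; so
the interpretation can be extended at the new names without changing it at the live ones. -/
theorem SymInv.step_move {p : Program} {o : List ℕ → Bool} {D D' S ν A σ n P P' q As ms B α}
    (inv : SymInv p o D S ν) (hA : S A = some ⟨σ ++ [n], P, q⟩)
    (hm : Move S.usedActors (σ ++ [n + 1]) P P' As ms α) (hms : ∀ m ∈ ms, m.target.cls = B.cls)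
    (hB : S B ≠ none) (fresh : σ ++ [n + 1] ∉ D)
    (hf : ∀ Q₁ Q₂, P = .choice Q₁ Q₂ → P' = if o (σ ++ [n + 1]) then Q₁ else Q₂)
    (hD : ∀ τ, τ ∈ D' ↔ τ ∈ D ∨ τ = σ ++ [n + 1]) :
    ∃ ν', SymInv p o D' (S.after A (σ ++ [n + 1]) P' B ms As) ν' ∧ LabelSpec p o ν' α := by
  obtain ⟨Q, hQ, hPQ⟩ := inv.proc A _ hA (by simp)
  dsimp only at hQ hPQ
  subst hPQ
  obtain ⟨ν', hν', hold, hnew⟩ := inv.interp.extend_act (σ ++ [n + 1]) As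
  have used : ∀ C t, S C = some t → C ∉ As := fun C t hC h => hm.fresh.2 C h (.inl (by simp [hC]))
  have old : ∀ a, Live p o S a → ν' a = ν a := by
    intro a ha
    refine hold a fun e => ?_
    rcases inv.origin a ha with h | h
    · simp [h] at e
    · exact fresh (e ▸ h)
  have inj := injOn_extend (L := Live p o S) hnew
    (hm.fresh.1.map fun _ _ e => Value.actor.inj e) old inv.inj (by
      intro a ha h
      obtain ⟨C, hC, e⟩ := List.mem_map.1 h
      exact hm.fresh.2 C hC (.inr (e ▸ inv.occurs ha)))
  have liveQ : ∀ a ∈ Q.names, Live p o S a := fun a ha => .inl ⟨A, _, _, Q, hA, hQ, ha⟩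
  obtain ⟨⟨Q', hs, rfl, hQ'⟩, hcls, hsend⟩ := hm.symbolic (o := o) inv.interp
    (fun a ha => old a (liveQ a ha)) hnew
    (fun a b ha hb => inj a b (ha.imp_left (liveQ a)) (hb.imp_left (liveQ b))) (by
      rintro Q₁ Q₂ rfl
      rw [hf _ _ rfl]
      split_ifs <;> rfl)
  have tree' : Tree p o (σ ++ [n + 1]) A.cls Q' := hQ.step hs
  have hmsg : ∀ C t m, S C = some t → m ∈ (if C = B then t.queue ++ ms else t.queue) →
      m ∈ t.queue ∨ (C = B ∧ ∃ M, TMsg p o m.seq C.cls M ∧ m.meth = M.meth ∧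
        m.args = M.args.map ν' ∧ ν' M.target = .actor m.target ∧
        ∀ a ∈ M.names, Live p o S a ∨ a ∈ createdNames (σ ++ [n + 1]) 0 As) := by
    intro C t m hC h
    split_ifs at h with hCB
    · rcases List.mem_append.1 h with h | h
      · exact .inl h
      · right
        refine ⟨hCB, ?_⟩
        rcases hsend with ⟨rfl, -⟩ | ⟨τ, k, K, m', Es, P1, A', rfl, hA', hK, rfl, -, hnames⟩
        · simp at h
        · have htarget : SName.act τ k K ∈ (Proc.send (.act τ k K) m' Es P1).names := by
            simp [Proc.names]
          rw [List.mem_singleton] at h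
          subst h
          -- The abstract semantics may queue the message at another actor, but only of the class of
          -- its target, and `TMsg` records no more than the class.
          obtain rfl : C.cls = K := by
            rw [hCB, ← hms _ (List.mem_singleton.2 rfl), hK]
          refine ⟨_, TMsg.mk hQ, rfl, rfl, (old _ (liveQ _ htarget)).trans hA', ?_⟩
          intro a ha
          rcases List.mem_cons.1 ha with rfl | ha
          · exact .inl (liveQ _ htarget)
          · exact (hnames a ha).imp_left (liveQ a)
    · exact .inl h
  have live' : ∀ a, Live p o (S.after A (σ ++ [n + 1]) (Q'.map ν') B ms As) a →
      Live p o S a ∨ a ∈ createdNames (σ ++ [n + 1]) 0 As := by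
    rintro a (⟨C, t', c, R, hC, hR, ha⟩ | ⟨C, t', m, K, M, hC, hmq, hM, ha⟩)
    · rcases Config.after_eq_some hC with ⟨-, rfl⟩ | ⟨-, t, ht, rfl⟩
      · exact absurd rfl hR.ne_nil
      · by_cases hCA : C = A
        · simp only [hCA, if_true] at hR
          obtain ⟨-, rfl⟩ := hR.unique tree'
          exact (hQ' a ha).imp_left (liveQ a)
        · simp only [hCA, if_false] at hR
          exact .inl (.inl ⟨C, t, c, R, ht, hR, ha⟩)
    · rcases Config.after_eq_some hC with ⟨-, rfl⟩ | ⟨-, t, ht, rfl⟩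
      · simp at hmq
      · rcases hmsg C t m ht hmq with h | ⟨-, M', hM', -, -, -, h⟩
        · exact .inl (.inr ⟨C, t, m, K, M, ht, h, hM, ha⟩)
        · obtain ⟨-, rfl⟩ := hM.unique hM'
          exact h a ha
  have after_some : ∀ C t, S C = some t → S.after A (σ ++ [n + 1]) (Q'.map ν') B ms As C =
      some ⟨if C = A then σ ++ [n + 1] else t.seq, if C = A then Q'.map ν' else t.proc,
        if C = B then t.queue ++ ms else t.queue⟩ := by
    intro C t hC
    simp only [Config.after, if_neg (used C t hC), hC, Option.map_some]
  refine ⟨ν', ⟨hν', ?_, ?_, ?_, ?_, ?_, ?_, ?_, ?_⟩, ?_⟩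
  · intro C t' hC hnil
    rcases Config.after_eq_some hC with ⟨hCAs, rfl⟩ | ⟨-, t, ht, rfl⟩
    · refine ⟨rfl, _, (hD _).2 (.inr rfl), σ, n, _, Q, rfl, hQ, ?_⟩
      rw [← hcls]
      exact List.mem_map_of_mem hCAs
    · by_cases hCA : C = A
      · simp [hCA] at hnil
      · simp only [hCA, if_false] at hnil ⊢
        obtain ⟨h1, τ, hτ, h2⟩ := inv.idle C t ht hnil
        exact ⟨h1, τ, (hD _).2 (.inl hτ), h2⟩
  · intro C t' hC hne
    rcases Config.after_eq_some hC with ⟨hCAs, rfl⟩ | ⟨-, t, ht, rfl⟩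
    · simp at hne
    · by_cases hCA : C = A
      · simp only [hCA, if_true]
        exact ⟨Q', tree', rfl⟩
      · simp only [hCA, if_false] at hne ⊢
        obtain ⟨R, hR, e⟩ := inv.proc C t ht hne
        refine ⟨R, hR, e.trans (Proc.map_congr _ fun a ha => (old a ?_).symm)⟩
        exact .inl ⟨C, t, _, R, ht, hR, ha⟩
  · intro C t' m hC hmq
    rcases Config.after_eq_some hC with ⟨-, rfl⟩ | ⟨-, t, ht, rfl⟩
    · simp at hmq
    · rcases hmsg C t m ht hmq with h | ⟨-, M', hM', h1, h2, h3, -⟩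
      · obtain ⟨M, hM, h1, h2, h3⟩ := inv.msg C t m ht h
        have hlive : ∀ a ∈ M.names, Live p o S a :=
          fun a ha => .inr ⟨C, t, m, _, M, ht, h, hM, ha⟩
        refine ⟨M, hM, h1, ?_, ?_⟩
        · rw [h2]
          exact List.map_congr_left fun a ha =>
            (old a (hlive a (List.mem_cons_of_mem _ ha))).symm
        · rw [old _ (hlive _ List.mem_cons_self), h3]
      · exact ⟨M', hM', h1, h2, h3⟩
  · exact fun a b ha hb => inj a b (live' a ha) (live' b hb)
  · intro a ha
    rcases live' a ha with h | h
    · exact (inv.origin a h).imp_right fun h => (hD _).2 (.inl h)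
    · exact .inr ((hD _).2 (.inr (origin_of_mem_createdNames h)))
  · intro τ i c R hR hi
    rcases (hD _).1 hi with hi | hi
    · rcases inv.continues τ i c R hR hi with h | h | ⟨C, t, hC, h⟩
      · exact .inl ((hD _).2 (.inl h))
      · exact .inr (.inl h)
      · by_cases hCA : C = A
        · rw [hCA, hA] at hC
          cases hC
          obtain ⟨rfl, rfl⟩ := snoc_inj.1 h
          exact .inl ((hD _).2 (.inr rfl))
        · exact .inr (.inr ⟨C, _, after_some C t hC, by simpa [hCA] using h⟩)
    · exact .inr (.inr ⟨A, _, after_some A _ hA, by simp [hi]⟩)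
  · intro τ K M hM hτ
    rcases (hD _).1 hτ with hτ | rfl
    · rcases inv.delivered τ K M hM hτ with h | ⟨C, t, m, hC, hmq, h⟩
      · exact .inl ((hD _).2 (.inl h))
      · refine .inr ⟨C, _, m, after_some C t hC, ?_, h⟩
        dsimp only
        split_ifs
        · exact List.mem_append_left _ hmq
        · exact hmq
    · right
      -- The recipient exists, so the message really ends up in a queue.
      obtain ⟨tB, htB⟩ := Option.ne_none_iff_exists'.1 hB
      rcases hsend with ⟨-, -, hno⟩ | ⟨τ, k, K, m', Es, P1, A', rfl, hA', hK, rfl, -, hnames⟩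
      · exfalso
        generalize hτ : σ ++ [n + 1] = τ at hM
        cases hM with
        | mk hM =>
          obtain ⟨rfl, h⟩ := snoc_inj.1 hτ
          obtain rfl := Nat.succ.inj h
          exact hno _ _ _ _ (hQ.unique hM).2
      · refine ⟨B, _, ⟨⟨m', (seval (σ ++ [n + 1]) 0 Es).map ν', σ ++ [n + 1]⟩, A'⟩,
          after_some B tB htB, ?_, rfl⟩
        rw [if_pos rfl]
        exact List.mem_append_right _ (List.mem_singleton.2 rfl)
  · intro τ K hτ hK
    rcases (hD _).1 hτ with hτ | rfl
    · obtain ⟨C, hC, h⟩ := inv.creates τ K hτ hK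
      obtain ⟨t, ht⟩ := Option.ne_none_iff_exists'.1 hC
      exact ⟨C, by simp [after_some C t ht], h⟩
    · obtain ⟨τ, i, c, R, hτ, hR, h⟩ := hK
      obtain ⟨rfl, hi⟩ := snoc_inj.1 hτ
      obtain rfl := Nat.succ.inj hi
      rw [← (hQ.unique hR).2, ← hcls] at h
      obtain ⟨C, hC, rfl⟩ := List.mem_map.1 h
      exact ⟨C, by simp [Config.after, hC], rfl⟩
  · rcases hsend with ⟨-, rfl, hno⟩ | ⟨τ, k, K, m', Es, P1, A', rfl, hA', rfl, -, rfl, hnames⟩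
    · refine .inl ⟨⟨_, rfl⟩, fun K M hM => ?_⟩
      simp only [Label.seq] at hM
      generalize hτ : σ ++ [n + 1] = τ at hM
      cases hM with
      | mk hM =>
        obtain ⟨rfl, h⟩ := snoc_inj.1 hτ
        obtain rfl := Nat.succ.inj h
        exact hno _ _ _ _ (hQ.unique hM).2
    · refine .inr ⟨_, _, _, rfl, .mk hQ, fun a ha b hb => inj a b ?_ ?_⟩
      · exact (hnames a ha).imp_left (liveQ a)
      · exact (hnames b hb).imp_left (liveQ b)

theorem SymInv.step_inst {p : Program} {o : List ℕ → Bool} {D D' S ν A σ' m Us σ A' q d ys}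
    (inv : SymInv p o D S ν) (hA : S A = some ⟨σ', .nil, ⟨⟨m, Us, σ⟩, A'⟩ :: q⟩)
    (hd : p.defs A.cls m = some d) (hlen : Us.length = d.params.length)
    (hy : FreshVars (S.usedVars p) d.locals.length ys) (fresh : σ ++ [0] ∉ D)
    (hD : ∀ τ, τ ∈ D' ↔ τ ∈ D ∨ τ = σ ++ [0]) :
    ∃ ν', SymInv p o D' (S.set A ⟨σ ++ [0], d.inst A' Us ys, q⟩) ν' := by
  obtain ⟨M, hM, rfl, rfl, hT⟩ := inv.msg A _ _ hA List.mem_cons_self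
  dsimp only at hM hT
  have hylen := hy.fresh.1
  obtain ⟨ν', hν', hold, hnew⟩ := inv.interp.extend_fvar (σ ++ [0]) ys
    fun y h1 h2 => hy.fresh.2.2 y h1 (.inl h2)
  rw [hylen] at hnew
  have old : ∀ a, Live p o S a → ν' a = ν a := by
    intro a ha
    refine hold a fun e => ?_
    rcases inv.origin a ha with h | h
    · simp [h] at e
    · exact fresh (e ▸ h)
  have inj := injOn_extend (L := Live p o S) hnew
    (hy.fresh.2.1.map fun _ _ e => Value.var.inj e) old inv.inj (by
      intro a ha h
      obtain ⟨y, hy', e⟩ := List.mem_map.1 h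
      exact hy.fresh.2.2 y hy' (.inr (e ▸ inv.occurs ha)))
  have liveM : ∀ a ∈ M.names, Live p o S a :=
    fun a ha => .inr ⟨A, _, _, _, M, hA, List.mem_cons_self, hM, ha⟩
  have hlen' : M.args.length = d.params.length := by simpa using hlen
  have tree' := hM.inst hd hlen'
  have hinst : d.inst A' (M.args.map ν) ys = (d.sinst M.target M.args (σ ++ [0])).map ν' := by
    rw [← MethodDef.inst_eq (A := A') _ hν'.main hnew]
    · congr 1
      exact List.map_congr_left fun a ha => (old a (liveM a (List.mem_cons_of_mem _ ha))).symm
    · rw [old _ (liveM _ List.mem_cons_self), hT]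
  rw [hinst]
  have queue : ∀ C t, S.set A ⟨σ ++ [0], (d.sinst M.target M.args (σ ++ [0])).map ν', q⟩ C =
      some t → ∃ t', S C = some t' ∧ ∀ m ∈ t.queue, m ∈ t'.queue := by
    intro C t hC
    rcases Config.set_eq_some hC with ⟨rfl, rfl⟩ | ⟨hCA, hC⟩
    · exact ⟨_, hA, fun m hm => List.mem_cons_of_mem _ hm⟩
    · exact ⟨t, hC, fun m hm => hm⟩
  have live' : ∀ a,
      Live p o (S.set A ⟨σ ++ [0], (d.sinst M.target M.args (σ ++ [0])).map ν', q⟩) a →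
      Live p o S a ∨ a ∈ (List.range d.locals.length).map (SName.fvar (σ ++ [0])) := by
    rintro a (⟨C, t', c, R, hC, hR, ha⟩ | ⟨C, t', m, K, M', hC, hmq, hM', ha⟩)
    · rcases Config.set_eq_some hC with ⟨rfl, rfl⟩ | ⟨hCA, hC⟩
      · obtain ⟨-, rfl⟩ := hR.unique tree'
        rcases MethodDef.mem_names_sinst hlen' ha with rfl | ha | ha
        · exact .inl (liveM _ List.mem_cons_self)
        · exact .inl (liveM _ (List.mem_cons_of_mem _ ha))
        · exact .inr ha
      · exact .inl (.inl ⟨C, t', c, R, hC, hR, ha⟩)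
    · obtain ⟨t, ht, h⟩ := queue C t' hC
      exact .inl (.inr ⟨C, t, m, K, M', ht, h m hmq, hM', ha⟩)
  refine ⟨ν', hν', ?_, ?_, ?_, ?_, ?_, ?_, ?_, ?_⟩
  · intro C t' hC hnil
    rcases Config.set_eq_some hC with ⟨rfl, rfl⟩ | ⟨hCA, hC⟩
    · simp at hnil
    · obtain ⟨h1, τ, hτ, h2⟩ := inv.idle C t' hC hnil
      exact ⟨h1, τ, (hD _).2 (.inl hτ), h2⟩
  · intro C t' hC hne
    rcases Config.set_eq_some hC with ⟨rfl, rfl⟩ | ⟨hCA, hC⟩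
    · exact ⟨_, tree', rfl⟩
    · obtain ⟨R, hR, e⟩ := inv.proc C t' hC hne
      refine ⟨R, hR, e.trans (Proc.map_congr _ fun a ha => (old a ?_).symm)⟩
      exact .inl ⟨C, t', _, R, hC, hR, ha⟩
  · intro C t' m hC hmq
    obtain ⟨t, ht, h⟩ := queue C t' hC
    obtain ⟨M, hM, h1, h2, h3⟩ := inv.msg C t m ht (h m hmq)
    have hlive : ∀ a ∈ M.names, Live p o S a :=
      fun a ha => .inr ⟨C, t, m, _, M, ht, h m hmq, hM, ha⟩
    refine ⟨M, hM, h1, ?_, ?_⟩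
    · rw [h2]
      exact List.map_congr_left fun a ha => (old a (hlive a (List.mem_cons_of_mem _ ha))).symm
    · rw [old _ (hlive _ List.mem_cons_self), h3]
  · exact fun a b ha hb => inj a b (live' a ha) (live' b hb)
  · intro a ha
    rcases live' a ha with h | h
    · exact (inv.origin a h).imp_right fun h => (hD _).2 (.inl h)
    · obtain ⟨k, -, rfl⟩ := List.mem_map.1 h
      exact .inr ((hD _).2 (.inr rfl))
  · intro τ i c R hR hi
    rcases (hD _).1 hi with hi | hi
    · rcases inv.continues τ i c R hR hi with h | h | ⟨C, t, hC, h⟩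
      · exact .inl ((hD _).2 (.inl h))
      · exact .inr (.inl h)
      · by_cases hCA : C = A
        · refine .inr (.inl ?_)
          rw [hCA, hA] at hC
          cases hC
          dsimp only at h
          subst h
          -- The node that `A` abandons has terminated: its instance is `0`, and interpretation
          -- preserves the shape of processes.
          obtain ⟨R', hR', e⟩ := inv.proc A _ hA (by simp)
          rw [(hR.unique hR').2]
          exact Proc.map_eq_nil e.symm
        · exact .inr (.inr ⟨C, t, (if_neg hCA).trans hC, h⟩)
    · exact .inr (.inr ⟨A, _, if_pos rfl, hi.symm⟩)
  · intro τ K M' hM' hτ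
    rcases (hD _).1 hτ with hτ | rfl
    · rcases inv.delivered τ K M' hM' hτ with h | ⟨C, t, m, hC, hmq, h⟩
      · exact .inl ((hD _).2 (.inl h))
      · by_cases hCA : C = A
        · rw [hCA, hA] at hC
          cases hC
          rcases List.mem_cons.1 hmq with rfl | hmq
          · exact .inl ((hD _).2 (.inr (by rw [← h])))
          · exact .inr ⟨A, _, m, if_pos rfl, hmq, h⟩
        · exact .inr ⟨C, t, m, (if_neg hCA).trans hC, hmq, h⟩
    · exact absurd hM' Tree.not_tMsg_zero
  · intro τ K hτ hK
    rcases (hD _).1 hτ with hτ | rfl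
    · obtain ⟨C, hC, h⟩ := inv.creates τ K hτ hK
      refine ⟨C, ?_, h⟩
      simp only [Config.set]
      split_ifs <;> simp [hC]
    · exact absurd hK not_creates_zero

theorem SymInv.step {p : Program} {o : List ℕ → Bool} {D D' S ν α S'} (inv : SymInv p o D S ν)
    (sinv : SeqInv D S) (h : AStepFollowing p o S α S')
    (hD : ∀ τ, τ ∈ D' ↔ τ ∈ D ∨ τ = α.seq) :
    ∃ ν', SymInv p o D' S' ν' ∧ LabelSpec p o ν' α := by
  obtain ⟨A, h, hf⟩ := h
  have fresh := sinv.fresh h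
  rcases h.normal_form with ⟨σ, n, P, P', q, As, ms, B, hA, hm, hms, hB, rfl⟩ |
    ⟨σ', σ, m, Us, A', q, d, ys, hA, hd, hlen, hy, rfl, rfl⟩
  · rw [hm.label_seq] at hD fresh
    refine inv.step_move hA hm hms hB fresh ?_ hD
    intro Q₁ Q₂ hP
    have hAs : A ∉ As := fun h => hm.fresh.2 A h (.inl (by simp [hA]))
    have := hf _ _ Q₁ Q₂ hA (by simp only [Config.after, if_neg hAs, hA]; rfl) hP
    simpa [hm.label_seq] using this
  · obtain ⟨ν', h⟩ := inv.step_inst hA hd hlen hy fresh hD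
    exact ⟨ν', h, .inl ⟨⟨_, rfl⟩, fun _ _ => Tree.not_tMsg_zero⟩⟩

theorem AStepFollowing.aStep {p : Program} {o S α S'} (h : AStepFollowing p o S α S') :
    AStep p S α S' :=
  let ⟨A, h, _⟩ := h
  ⟨A, h⟩

theorem Run.symInv {p : Program} {o l S}
    (h : Run (AStepFollowing p o) (p.initial AMsg) l S) : ∃ ν, SymInv p o (done l) S ν := by
  induction h with
  | nil => exact symInv_initial p o
  | snoc h hR ih =>
    obtain ⟨ν, hν⟩ := ih
    obtain ⟨ν', h', -⟩ := hν.step (h.mono fun _ _ _ => AStepFollowing.aStep).seqInv hR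
      (done_snoc _ (_, _))
    exact ⟨ν', h'⟩

/-! ### Concrete runs can execute every symbolic transition -/

def CStepFollowing (p : Program) (o : List ℕ → Bool) (S : Config Msg) (α : Label)
    (S' : Config Msg) : Prop :=
  ∃ A, CStepBy p A S α S' ∧ Follows o A S α S'

theorem CStepFollowing.cStep {p : Program} {o S α S'} (h : CStepFollowing p o S α S') :
    CStep p S α S' :=
  let ⟨A, h, _⟩ := h
  ⟨A, h⟩

theorem CStepFollowing.omega {p : Program} {o S α S'} (h : CStepFollowing p o S α S') :
    AStepFollowing p o (Omega S) α (Omega S') := by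
  obtain ⟨A, h, hf⟩ := h
  refine ⟨A, h.omega, fun t t' P Q ht ht' hP => ?_⟩
  obtain ⟨t, hA, rfl⟩ := Option.map_eq_some_iff.1 ht
  obtain ⟨t', hA', rfl⟩ := Option.map_eq_some_iff.1 ht'
  exact hf t t' P Q hA hA' hP

theorem Run.omega_following {p : Program} {o l S}
    (h : Run (CStepFollowing p o) (p.initial Msg) l S) :
    Run (AStepFollowing p o) (p.initial AMsg) (l.map fun e => (e.1, Omega e.2)) (Omega S) :=
  h.omega fun _ _ _ => CStepFollowing.omega

theorem Run.symInv_omega {p : Program} {o l S}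
    (h : Run (CStepFollowing p o) (p.initial Msg) l S) :
    ∃ ν, SymInv p o (done l) (Omega S) ν := by
  have := h.omega_following.symInv
  rwa [done_omega] at this

/-- The two cases give the measures for scheduling one actor: a running process shrinks while its
queue grows only at the end, and an idle one consumes its oldest message. -/
theorem CStepBy.at_actor {p : Program} {A S α S' t} (h : CStepBy p A S α S')
    (hA : S A = some t) :
    (∃ t', S' A = some t' ∧ t'.proc.size < t.proc.size ∧ (∃ q, t'.queue = t.queue ++ q) ∧
      ∀ τ n, t.seq = τ ++ [n] → α.seq = τ ++ [n + 1]) ∨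
    (t.proc = .nil ∧ ∃ m q t', t.queue = m :: q ∧ S' A = some t' ∧ t'.queue = q ∧
      α.seq = m.seq ++ [0]) := by
  have seq_succ : ∀ (σ τ : List ℕ) (n k : ℕ), σ ++ [n] = τ ++ [k] → σ ++ [n + 1] = τ ++ [k + 1] := by
    intro σ τ n k h
    obtain ⟨rfl, rfl⟩ := snoc_inj.1 h
    rfl
  have hused : A ∈ S.usedActors := .inl (by simp [hA])
  cases h with
  | internal hA' hP =>
    cases hA.symm.trans hA'
    have hAs := fun h => hP.fresh.2 A h hused
    exact .inl ⟨_, by simp only [Config.spawn, if_neg hAs, Config.set, if_true]; rfl, hP.size_lt,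
      ⟨[], by simp⟩, fun τ n => seq_succ _ _ _ _⟩
  | invkSelf hA' hE =>
    cases hA.symm.trans hA'
    have hAs := fun h => hE.fresh.2 A h hused
    exact .inl ⟨_, by simp only [Config.spawn, if_neg hAs, Config.set, if_true]; rfl,
      by simp [Proc.size], ⟨_, rfl⟩, fun τ n => seq_succ _ _ _ _⟩
  | invk hne hA' hA'' hE =>
    cases hA.symm.trans hA'
    have hAs := fun h => hE.fresh.2 A h hused
    exact .inl ⟨_, by simp only [Config.spawn, if_neg hAs, Config.set, if_true, if_neg hne.symm]; rfl,
      by simp [Proc.size], ⟨[], by simp⟩, fun τ n => seq_succ _ _ _ _⟩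
  | inst hA' hd hlen hy =>
    cases hA.symm.trans hA'
    exact .inr ⟨rfl, _, _, _, rfl, if_pos rfl, rfl, rfl⟩

/-! ### Scheduling in non-blocking programs. -/

variable {p : Program} {o : List ℕ → Bool}

/-- Only at a choice may the move granted by non-blocking contradict `o`, and there the other branch
is available as well. -/
theorem Program.NonBlocking.exists_step (hp : p.NonBlocking) {l S A t}
    (h : Run (CStepFollowing p o) (p.initial Msg) l S) (hA : S A = some t)
    (ht : t.proc ≠ .nil ∨ t.queue ≠ []) :
    ∃ α S', CStepBy p A S α S' ∧ Follows o A S α S' := by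
  obtain ⟨α, S', hs⟩ := hp S (h.mono fun _ _ _ => CStepFollowing.cStep).reachable A t hA ht
  by_cases hc : ∃ P Q, t.proc = .choice P Q
  · obtain ⟨P, Q, hPQ⟩ := hc
    obtain ⟨σ, R, q⟩ := t
    dsimp only at hPQ
    subst hPQ
    -- That some move exists shows that the decoration is nonempty, as the rules require.
    obtain ⟨τ, n, rfl⟩ : ∃ τ n, σ = τ ++ [n] := by
      cases hs with
      | internal hA' hP => cases hA.symm.trans hA'; exact ⟨_, _, rfl⟩
      | invkSelf hA' => cases hA.symm.trans hA'
      | invk _ hA' => cases hA.symm.trans hA'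
      | inst hA' => cases hA.symm.trans hA'
    have hstep : ProcStep S.usedActors (.choice P Q)
        (if o (τ ++ [n + 1]) then P else Q) [] := by
      split_ifs
      · exact .left P Q
      · exact .right P Q
    refine ⟨_, _, .internal hA hstep, fun t t' P' Q' ht ht' hP' => ?_⟩
    cases hA.symm.trans ht
    cases hP'
    simp only [Config.spawn, List.not_mem_nil, if_false, Config.set, if_true,
      Option.some.injEq] at ht'
    rw [← ht']
    rfl
  · refine ⟨α, S', hs, fun t₁ t' P Q ht₁ _ hP => ?_⟩
    cases hA.symm.trans ht₁
    exact absurd ⟨P, Q, hP⟩ hc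

theorem Proc.eq_nil_of_size {α : Type} {P : Proc α} (h : P.size = 0) : P = .nil := by
  cases P <;> simp_all [Proc.size]

/-- Scheduling `A` alone, by induction on a bound for the size of its process. -/
theorem Program.NonBlocking.run_to_nil (hp : p.NonBlocking) {A} (n : ℕ) : ∀ {l S t},
    Run (CStepFollowing p o) (p.initial Msg) l S → S A = some t → t.proc.size ≤ n →
    ∃ l' S' t', Run (CStepFollowing p o) (p.initial Msg) (l ++ l') S' ∧ S' A = some t' ∧
      t'.proc = .nil ∧ ∃ q, t'.queue = t.queue ++ q := by
  induction n with
  | zero =>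
    intro l S t h hA ht
    exact ⟨[], S, t, by simpa using h, hA, Proc.eq_nil_of_size (by omega), [], by simp⟩
  | succ n ih =>
    intro l S t h hA ht
    by_cases hnil : t.proc = .nil
    · exact ⟨[], S, t, by simpa using h, hA, hnil, [], by simp⟩
    · obtain ⟨α, S', hs, hf⟩ := hp.exists_step h hA (.inl hnil)
      rcases hs.at_actor hA with ⟨t', hA', hlt, ⟨q, hq⟩, -⟩ | ⟨h0, -⟩
      · obtain ⟨l', S'', t'', h'', hA'', hn'', q', hq'⟩ := ih (h.snoc ⟨A, hs, hf⟩) hA' (by omega)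
        refine ⟨_, S'', t'', by rwa [List.append_assoc] at h'', hA'', hn'', q ++ q', ?_⟩
        rw [hq', hq, List.append_assoc]
      · exact absurd h0 hnil

/-- Induction on the messages ahead of `m`: finish the current process, consume the head, repeat.
Messages arriving meanwhile are behind `m`. -/
theorem Program.NonBlocking.run_message (hp : p.NonBlocking) {A} {m : Msg}
    (q₁ : List Msg) : ∀ {l S t q₂},
    Run (CStepFollowing p o) (p.initial Msg) l S → S A = some t → t.queue = q₁ ++ m :: q₂ →
    ∃ l' S', Run (CStepFollowing p o) (p.initial Msg) (l ++ l') S' ∧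
      m.seq ++ [0] ∈ done (l ++ l') := by
  induction q₁ with
  | nil =>
    intro l S t q₂ h hA hq
    obtain ⟨l₁, S₁, t₁, h₁, hA₁, hn₁, q, hq₁⟩ := hp.run_to_nil _ h hA le_rfl
    obtain ⟨α, S', hs, hf⟩ := hp.exists_step h₁ hA₁ (.inr (by simp [hq₁, hq]))
    rcases hs.at_actor hA₁ with ⟨t', -, hlt, -⟩ | ⟨-, m', q', t', e, -, -, hα⟩
    · simp [hn₁, Proc.size] at hlt
    · rw [hq₁, hq] at e
      cases e
      have h' := h₁.snoc ⟨A, hs, hf⟩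
      rw [List.append_assoc] at h'
      refine ⟨_, _, h', ?_⟩
      rw [← List.append_assoc, done_snoc]
      exact .inr hα.symm
  | cons m₀ q₁ ih =>
    intro l S t q₂ h hA hq
    obtain ⟨l₁, S₁, t₁, h₁, hA₁, hn₁, q, hq₁⟩ := hp.run_to_nil _ h hA le_rfl
    obtain ⟨α, S', hs, hf⟩ := hp.exists_step h₁ hA₁ (.inr (by simp [hq₁, hq]))
    rcases hs.at_actor hA₁ with ⟨t', -, hlt, -⟩ | ⟨-, m', q', t', e, hA', hq', -⟩
    · simp [hn₁, Proc.size] at hlt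
    · rw [hq₁, hq] at e
      simp only [List.cons_append, List.append_assoc, List.cons.injEq] at e
      obtain ⟨l₂, S₂, h₂, hd⟩ := ih (h₁.snoc ⟨A, hs, hf⟩) hA' (hq'.trans e.2.symm)
      simp only [List.append_assoc] at h₂ hd
      exact ⟨_, _, h₂, hd⟩

theorem done_subset_append {M : Type} (l l' : List (Label × Config M)) : done l ⊆ done (l ++ l') := by
  intro σ h
  simp only [done, List.mem_cons, List.map_append, List.mem_append] at h ⊢
  tauto

theorem Program.NonBlocking.run_succ (hp : p.NonBlocking) {σ n c Q l S}
    (hQ : Tree p o (σ ++ [n]) c Q) (hnil : Q ≠ .nil)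
    (h : Run (CStepFollowing p o) (p.initial Msg) l S) (hσ : σ ++ [n] ∈ done l) :
    ∃ l' S', Run (CStepFollowing p o) (p.initial Msg) (l ++ l') S' ∧
      σ ++ [n + 1] ∈ done (l ++ l') := by
  obtain ⟨ν, inv⟩ := h.symInv_omega
  rcases inv.continues σ n c Q hQ hσ with h' | h' | ⟨A, t, hA, ht⟩
  · exact ⟨[], S, by simpa using h, by simpa using h'⟩
  · exact absurd h' hnil
  · obtain ⟨R, hR, e⟩ := inv.proc A t hA (by simp [ht])
    rw [ht] at hR
    obtain ⟨-, rfl⟩ := hQ.unique hR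
    obtain ⟨t, hA', rfl⟩ := Option.map_eq_some_iff.1 hA
    dsimp only at e ht
    have hne : t.proc ≠ .nil := fun h0 => hnil (Proc.map_eq_nil (e.symm.trans h0))
    obtain ⟨α, S', hs, hf⟩ := hp.exists_step h hA' (.inl hne)
    rcases hs.at_actor hA' with ⟨t', -, -, -, hα⟩ | ⟨h0, -⟩
    · refine ⟨_, _, h.snoc ⟨A, hs, hf⟩, ?_⟩
      rw [done_snoc]
      exact .inr (hα σ n ht).symm
    · exact absurd h0 hne

/-- The starting run is arbitrary, so nodes can be performed one after another and any finite set of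
them by a single run. In the induction, `continues` locates the actor to schedule and `delivered`
the queue holding the message. -/
theorem Program.NonBlocking.run_tree (hp : p.NonBlocking) {σ c Q} (hQ : Tree p o σ c Q) :
    ∀ {l S}, Run (CStepFollowing p o) (p.initial Msg) l S →
    ∃ l' S', Run (CStepFollowing p o) (p.initial Msg) (l ++ l') S' ∧ σ ∈ done (l ++ l') := by
  induction hQ with
  | root => exact fun {l S} h => ⟨[], S, by simpa using h, by simp [done]⟩
  | step hQ hs ih =>
    intro l S h
    obtain ⟨l₁, S₁, h₁, hd₁⟩ := ih h
    obtain ⟨l₂, S₂, h₂, hd₂⟩ := hp.run_succ hQ (by rintro rfl; cases hs) h₁ hd₁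
    rw [List.append_assoc] at h₂ hd₂
    exact ⟨_, _, h₂, hd₂⟩
  | inst hQ hd hlen ih =>
    intro l S h
    obtain ⟨l₁, S₁, h₁, hd₁⟩ := ih h
    obtain ⟨l₂, S₂, h₂, hd₂⟩ := hp.run_succ hQ (by simp) h₁ hd₁
    obtain ⟨ν, inv⟩ := h₂.symInv_omega
    rcases inv.delivered _ _ _ (.mk hQ) hd₂ with h' | ⟨A, t, m, hA, hm, hseq⟩
    · rw [List.append_assoc] at h₂ h'
      exact ⟨_, _, h₂, h'⟩
    · obtain ⟨t, hA', rfl⟩ := Option.map_eq_some_iff.1 hA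
      obtain ⟨m, hm', rfl⟩ := List.mem_map.1 hm
      obtain ⟨q₁, q₂, hq⟩ := List.append_of_mem hm'
      obtain ⟨l₃, S₃, h₃, hd₃⟩ := hp.run_message q₁ h₂ hA' hq
      dsimp only at hseq
      rw [hseq] at hd₃
      simp only [List.append_assoc _ _ l₃, List.append_assoc l] at h₃ hd₃
      exact ⟨_, _, h₃, hd₃⟩

theorem Program.NonBlocking.run_all (hp : p.NonBlocking) (s : List (List ℕ))
    (hs : ∀ σ ∈ s, ∃ c Q, Tree p o σ c Q) :
    ∃ l S, Run (CStepFollowing p o) (p.initial Msg) l S ∧ s ⊆ done l := by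
  induction s with
  | nil => exact ⟨[], _, .nil, by simp⟩
  | cons σ s ih =>
    obtain ⟨l, S, h, hd⟩ := ih fun τ hτ => hs τ (List.mem_cons_of_mem _ hτ)
    obtain ⟨c, Q, hQ⟩ := hs σ List.mem_cons_self
    obtain ⟨l', S', h', hd'⟩ := hp.run_tree hQ h
    exact ⟨_, _, h', List.cons_subset.2 ⟨hd', fun τ hτ => done_subset_append l l' (hd hτ)⟩⟩

/-! ### Every abstract run follows an oracle -/

theorem AStepBy.choice {p : Program} {A S α S' t t' P Q} (h : AStepBy p A S α S')
    (hA : S A = some t) (hA' : S' A = some t') (hP : t.proc = .choice P Q) :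
    t'.proc = P ∨ t'.proc = Q := by
  rcases h.normal_form with ⟨σ, n, P₁, P', q, As, ms, B, hA₁, hm, -, -, rfl⟩ |
    ⟨σ', σ, m, Us, A', q, d, ys, hA₁, -⟩
  · cases hA.symm.trans hA₁
    dsimp only at hP
    subst hP
    rcases Config.after_eq_some hA' with ⟨h, -⟩ | ⟨-, t, -, rfl⟩
    · exact absurd (.inl (by simp [hA])) (hm.fresh.2 A h)
    · simp only [if_true]
      rcases hm with ⟨_ | _ | _ | _ | _⟩
      · exact .inl rfl
      · exact .inr rfl
  · cases hA.symm.trans hA₁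
    cases hP

theorem seq_ne_of_lt {p : Program} {S : ℕ → Config AMsg} {α : ℕ → Label} {j : ℕ}
    (h0 : S 0 = p.initial AMsg) (h : ∀ i ≤ j, AStep p (S i) (α i) (S (i + 1))) :
    (α j).seq ≠ [0] ∧ ∀ i < j, (α i).seq ≠ (α j).seq := by
  have hrun := run_of_seq S α j fun i hi => h i hi.le
  rw [h0] at hrun
  obtain ⟨A, hA⟩ := h j le_rfl
  have fresh := hrun.seqInv.fresh hA
  simp only [done, List.mem_cons, List.map_map, List.mem_map, List.mem_range, not_or,
    not_exists, not_and] at fresh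
  exact ⟨fresh.1, fun i hi => fresh.2 i hi⟩

/-- Since decorations are never repeated, the choices of the run can be read off as a function of
the decoration. A downward closed `J` covers finite and infinite runs alike. -/
theorem exists_oracle {p : Program} {S : ℕ → Config AMsg} {α : ℕ → Label} {J : ℕ → Prop}
    (hJ : ∀ i j, i ≤ j → J j → J i) (h0 : S 0 = p.initial AMsg)
    (h : ∀ i, J i → AStep p (S i) (α i) (S (i + 1))) :
    ∃ o, ∀ i, J i → AStepFollowing p o (S i) (α i) (S (i + 1)) := by
  classical
  have h' : ∀ i, ∃ A, J i → AStepBy p A (S i) (α i) (S (i + 1)) := by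
    intro i
    by_cases hi : J i
    · obtain ⟨A, hA⟩ := h i hi
      exact ⟨A, fun _ => hA⟩
    · exact ⟨p.root, fun h => absurd h hi⟩
  choose A hA using h'
  have inj : ∀ i j, J i → J j → (α i).seq = (α j).seq → i = j := by
    intro i j hi hj e
    rcases lt_trichotomy i j with hlt | rfl | hlt
    · exact absurd e ((seq_ne_of_lt h0 fun k hk => h k (hJ k j hk hj)).2 i hlt)
    · rfl
    · exact absurd e.symm ((seq_ne_of_lt h0 fun k hk => h k (hJ k i hk hi)).2 j hlt)
  let goesLeft : ℕ → Prop := fun i => ∃ t t' P Q, S i (A i) = some t ∧ S (i + 1) (A i) = some t' ∧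
    t.proc = .choice P Q ∧ t'.proc = P
  refine ⟨fun σ => decide (∃ i, J i ∧ (α i).seq = σ ∧ goesLeft i), fun i hi => ⟨A i, hA i hi, ?_⟩⟩
  intro t t' P Q ht ht' hP
  by_cases hl : t'.proc = P
  · rw [if_pos]
    · exact hl
    · exact decide_eq_true ⟨i, hi, rfl, t, t', P, Q, ht, ht', hP, hl⟩
  · rw [if_neg]
    · exact ((hA i hi).choice ht ht' hP).resolve_left hl
    · intro h
      obtain ⟨j, hj, e, t₁, t₁', P₁, Q₁, ht₁, ht₁', hP₁, hl₁⟩ := of_decide_eq_true h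
      obtain rfl := inj j i hj hi e
      cases ht.symm.trans ht₁
      cases ht'.symm.trans ht₁'
      cases hP.symm.trans hP₁
      exact hl hl₁

/-! ### Comparison of two runs that follow the same oracle -/

theorem ProcEquiv.refl (p : Program) (P : Proc Value) : ProcEquiv p P P :=
  procEquiv_iff.2 ⟨id, (P.map_id' fun _ _ => rfl).symm, fun _ _ _ _ h => h, fun _ _ => .refl p _⟩

theorem AStepBy.label_seq_ne_nil {p : Program} {A S α S'} (h : AStepBy p A S α S') :
    α.seq ≠ [] := by
  rcases h.normal_form with ⟨σ, n, P, P', q, As, ms, B, -, hm, -⟩ |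
    ⟨σ', σ, m, Us, A', q, d, ys, -, -, -, -, rfl, -⟩
  · simp [hm.label_seq]
  · simp [Label.seq]

/-- All processes carrying the decoration of the label are images of one tree node under one
interpretation, whence the projection is unique. -/
theorem Run.node {p : Program} {o l S α S'} (h : Run (AStepFollowing p o) (p.initial AMsg) l S)
    (hs : AStepFollowing p o S α S') :
    ∃ ν c Q, Interp p ν ∧ LabelSpec p o ν α ∧ Tree p o α.seq c Q ∧ IsProj S' α (Q.map ν) ∧
      ∀ a ∈ Q.names, ∀ b ∈ Q.names, ν a = ν b → a = b := by
  obtain ⟨ν₀, inv₀⟩ := h.symInv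
  obtain ⟨ν, inv, hl⟩ := inv₀.step (h.mono fun _ _ _ => AStepFollowing.aStep).seqInv hs
    (done_snoc _ (_, S'))
  obtain ⟨A, hA, -⟩ := hs
  obtain ⟨P, q, hP⟩ := hA.exists_label_seq
  obtain ⟨Q, hQ, hPQ⟩ := inv.proc A _ hP hA.label_seq_ne_nil
  dsimp only at hQ hPQ
  refine ⟨ν, _, Q, inv.interp, hl, hQ, fun R => ⟨?_, ?_⟩, fun a ha b hb =>
    inv.inj a b (.inl ⟨A, _, _, Q, hP, hQ, ha⟩) (.inl ⟨A, _, _, Q, hP, hQ, hb⟩)⟩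
  · rintro ⟨B, q', hB⟩
    obtain ⟨Q', hQ', e⟩ := inv.proc B _ hB hA.label_seq_ne_nil
    dsimp only at hQ' e
    rw [e, (hQ.unique hQ').2]
  · rintro rfl
    exact ⟨A, q, hPQ ▸ hP⟩

/-- Whether a transition sends, and what, is determined by the tree; only the interpretations of the
arguments differ. -/
theorem LabelSpec.equiv {p : Program} {o ν ν' α α'} (h : LabelSpec p o ν α)
    (h' : LabelSpec p o ν' α') (hν : Interp p ν) (hν' : Interp p ν') (e : α.seq = α'.seq) :
    LabelEquiv p α α' := by
  rcases h with ⟨⟨σ, rfl⟩, hno⟩ | ⟨σ, M, A, rfl, hM, inj⟩ <;>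
    rcases h' with ⟨⟨σ', rfl⟩, hno'⟩ | ⟨σ', M', A', rfl, hM', inj'⟩ <;>
    simp only [Label.seq] at e <;> subst e
  · rfl
  · exact absurd hM' (hno _ _)
  · exact absurd hM (hno' _ _)
  · obtain ⟨hc, rfl⟩ := hM.unique hM'
    exact ⟨rfl, invEquiv_map _ _ ν ν' inj inj' fun a _ => hν.kindPreserving hν' a, hc⟩

theorem isProj_omega {S : Config Msg} {α P} : IsProj (Omega S) α P ↔ IsProj S α P := by
  refine forall_congr' fun Q => iff_congr ⟨?_, ?_⟩ Iff.rfl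
  · rintro ⟨A, q, h⟩
    obtain ⟨⟨σ, R, q'⟩, hA, e⟩ := Option.map_eq_some_iff.1 h
    cases e
    exact ⟨A, q', hA⟩
  · rintro ⟨A, q, h⟩
    exact ⟨A, _, omega_eq_some h⟩

theorem Run.compare {p : Program} {o l S α S' l₁ S₁ α₁ S₁'}
    (h : Run (AStepFollowing p o) (p.initial AMsg) l S) (hs : AStepFollowing p o S α S')
    (h₁ : Run (CStepFollowing p o) (p.initial Msg) l₁ S₁) (hs₁ : CStepFollowing p o S₁ α₁ S₁')
    (e : α.seq = α₁.seq) :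
    LabelEquiv p α α₁ ∧ ∃ P P', IsProj S' α P ∧ IsProj S₁' α₁ P' ∧ ProcEquiv p P P' := by
  obtain ⟨ν, c, Q, hν, hl, hQ, hP, inj⟩ := h.node hs
  obtain ⟨ν', c', Q', hν', hl', hQ', hP', inj'⟩ := h₁.omega_following.node hs₁.omega
  rw [e] at hQ
  obtain ⟨-, rfl⟩ := hQ.unique hQ'
  exact ⟨hl.equiv hl' hν hν' e, _, _, hP, isProj_omega.1 hP',
    procEquiv_map Q ν ν' inj inj' fun a _ => hν.kindPreserving hν' a⟩

/-! ### Reachability of control states -/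

/-- The final configuration may have moved past `σ`, so the run is cut just after the transition
that reached it. -/
theorem Run.exists_active {p : Program} {o l S σ}
    (h : Run (CStepFollowing p o) (p.initial Msg) l S) (hσ : σ ∈ done l) :
    ∃ l' S', Run (CStepFollowing p o) (p.initial Msg) l' S' ∧
      ∃ A P q, S' A = some ⟨σ, P, q⟩ := by
  induction h with
  | nil =>
    rw [List.mem_singleton.1 hσ]
    exact ⟨_, _, .nil, p.root, _, _, if_pos rfl⟩
  | snoc h hR ih =>
    rcases (done_snoc _ _ _).1 hσ with hσ | rfl
    · exact ih hσ
    · refine ⟨_, _, h.snoc hR, ?_⟩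
      obtain ⟨A, hA, -⟩ := hR
      obtain ⟨P, q, hP⟩ := hA.omega.exists_label_seq
      obtain ⟨⟨σ, R, q'⟩, hA, e⟩ := Option.map_eq_some_iff.1 hP
      cases e
      exact ⟨A, _, _, hA⟩

theorem Run.reachable_following {p : Program} {o l S}
    (h : Run (CStepFollowing p o) (p.initial Msg) l S) : Reachable (CStep p) (p.initial Msg) S :=
  (h.mono fun _ _ _ => CStepFollowing.cStep).reachable

theorem run_oracle {p : Program} {l S} (h : Run (AStep p) (p.initial AMsg) l S) :
    ∃ o, Run (AStepFollowing p o) (p.initial AMsg) l S := by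
  obtain ⟨T, h0, hn, hT⟩ := h.exists_seq
  let α : ℕ → Label := fun i => if hi : i < l.length then l[i].1 else .silent []
  have hα : ∀ i (hi : i < l.length), α i = l[i].1 := fun i hi => dif_pos hi
  obtain ⟨o, ho⟩ := exists_oracle (S := T) (α := α) (J := (· < l.length))
    (fun i j hij hj => lt_of_le_of_lt hij hj) h0 fun i hi => by
      rw [hα i hi]; exact (hT i hi).2.1
  refine ⟨o, ?_⟩
  have hrun := run_of_seq T α l.length ho
  rw [h0, hn] at hrun
  convert hrun using 1
  refine List.ext_getElem (by simp) fun i h1 h2 => ?_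
  simp only [List.getElem_map, List.getElem_range]
  rw [hα i h1, (hT i h1).2.2]

/-- An actor that has run holds an instance of a tree node, which some concrete run reaches. One
that has never run has process `0`, and performing concretely the transition that created it yields
an actor of the same class. -/
theorem Program.NonBlocking.reach_control {p : Program} (hp : p.NonBlocking) {S A t}
    (h : Reachable (AStep p) (p.initial AMsg) S) (hA : S A = some t) :
    ∃ S' A' t', Reachable (CStep p) (p.initial Msg) S' ∧ S' A' = some t' ∧ A'.cls = A.cls ∧
      ProcEquiv p t.proc t'.proc := by
  obtain ⟨l, hl⟩ := h.exists_run
  obtain ⟨o, hl⟩ := run_oracle hl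
  obtain ⟨ν, inv⟩ := hl.symInv
  by_cases hseq : t.seq = []
  · obtain ⟨hnil, σ, -, hC⟩ := inv.idle A t hA hseq
    obtain ⟨τ, n, c, Q, rfl, hQ, hmem⟩ := id hC
    obtain ⟨Q', hQ'⟩ : ∃ Q', sstep o (τ ++ [n + 1]) Q = some Q' := by
      rw [← Option.ne_none_iff_exists', ne_eq, sstep_eq_none]
      rintro rfl
      simp [Proc.headCreated] at hmem
    obtain ⟨l₁, S₁, h₁, hd⟩ := hp.run_tree (hQ.step hQ') .nil
    obtain ⟨ν₁, inv₁⟩ := h₁.symInv_omega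
    obtain ⟨B, hB, hBA⟩ := inv₁.creates _ _ hd hC
    rw [ne_eq, omega_eq_none, ← ne_eq, Option.ne_none_iff_exists'] at hB
    obtain ⟨tB, hB⟩ := hB
    -- The actor of this class found concretely may be busy, so it is run until its process is `0`.
    obtain ⟨l₂, S₂, t₂, h₂, hB₂, hn₂, -⟩ := hp.run_to_nil _ h₁ hB le_rfl
    refine ⟨S₂, B, t₂, h₂.reachable_following, hB₂, hBA, ?_⟩
    rw [hnil, hn₂]
    exact .refl p _
  · obtain ⟨Q, hQ, e⟩ := inv.proc A t hA hseq
    obtain ⟨l₁, S₁, h₁, hd⟩ := hp.run_tree hQ .nil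
    obtain ⟨l₂, S₂, h₂, B, P, q, hB⟩ := h₁.exists_active hd
    obtain ⟨ν₂, inv₂⟩ := h₂.symInv_omega
    have hB' := omega_eq_some hB
    obtain ⟨Q', hQ', e'⟩ := inv₂.proc B _ hB' hseq
    obtain ⟨hc, rfl⟩ := hQ.unique hQ'
    refine ⟨S₂, B, _, h₂.reachable_following, hB, hc.symm, ?_⟩
    dsimp only at e' ⊢
    rw [e, e']
    exact procEquiv_map Q ν ν₂
      (fun a ha b hb => inv.inj a b (.inl ⟨A, t, _, Q, hA, hQ, ha⟩)
        (.inl ⟨A, t, _, Q, hA, hQ, hb⟩))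
      (fun a ha b hb => inv₂.inj a b (.inl ⟨B, _, _, Q, hB', hQ', ha⟩)
        (.inl ⟨B, _, _, Q, hB', hQ', hb⟩))
      fun a _ => inv.interp.kindPreserving inv₂.interp a

theorem Reachable.omega {p : Program} {S : Config Msg}
    (h : Reachable (CStep p) (p.initial Msg) S) :
    Reachable (AStep p) (p.initial AMsg) (Omega S) := by
  obtain ⟨l, hl⟩ := h.exists_run
  exact (hl.omega fun _ _ _ => CStep.omega).reachable

theorem Program.NonBlocking.reachesControl_iff {p : Program} (hp : p.NonBlocking) (C : ClassName)
    (Q : Proc Value) :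
    ReachesControl p (AStep p) (p.initial AMsg) C Q ↔
      ReachesControl p (CStep p) (p.initial Msg) C Q := by
  constructor
  · rintro ⟨S, hS, A, t, hA, rfl, hQ⟩
    obtain ⟨S', A', t', hS', hA', hc, he⟩ := hp.reach_control hS hA
    exact ⟨S', hS', A', t', hA', hc, hQ.trans he⟩
  · rintro ⟨S, hS, A, t, hA, hc, hQ⟩
    exact ⟨Omega S, hS.omega, A, _, omega_eq_some hA, hc, hQ⟩

/-! ### Infinite computations -/

/-- The list records the targets of the transitions, so its last entry is the final configuration.
-/
theorem Run.unique {M : Type} {R : Config M → Label → Config M → Prop} {S₀ l S S'}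
    (h : Run R S₀ l S) (h' : Run R S₀ l S') : S = S' := by
  obtain ⟨T, h0, hn, hT⟩ := h.exists_seq
  obtain ⟨T', h0', hn', hT'⟩ := h'.exists_seq
  rw [← hn, ← hn']
  rcases Nat.eq_zero_or_pos l.length with hl | hl
  · rw [hl, h0, h0']
  · have h1 := (hT (l.length - 1) (by omega)).2.2
    have h2 := (hT' (l.length - 1) (by omega)).2.2
    rw [Nat.sub_add_cancel hl] at h1 h2
    rw [h1, h2]

/-- An extension performing a node not yet done is proper, and its first transition starts at `S`.
-/
theorem Program.NonBlocking.exists_next {p : Program} (hp : p.NonBlocking) {o l S σ c Q}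
    (h : Run (CStepFollowing p o) (p.initial Msg) l S) (hQ : Tree p o σ c Q) (hσ : σ ∉ done l) :
    ∃ α S', CStepFollowing p o S α S' := by
  obtain ⟨l', S', h', hd⟩ := hp.run_tree hQ h
  obtain ⟨T, -, -, hT⟩ := h'.exists_seq
  have hl : l.length < (l ++ l').length := by
    rcases l' with _ | ⟨e, l'⟩
    · rw [List.append_nil] at hd
      exact absurd hd hσ
    · simp
  obtain ⟨h1, h2, -⟩ := hT l.length hl
  rw [List.take_left] at h1
  rw [← h.unique h1] at h2
  exact ⟨_, _, h2⟩

theorem Program.NonBlocking.hasInfiniteComputation_iff {p : Program} (hp : p.NonBlocking) :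
    HasInfiniteComputation (AStep p) (p.initial AMsg) ↔
      HasInfiniteComputation (CStep p) (p.initial Msg) := by
  constructor
  · rintro ⟨S, h0, hS⟩
    choose α hS using hS
    obtain ⟨o, ho⟩ := exists_oracle (J := fun _ => True) (fun _ _ _ _ => trivial) h0
      fun i _ => hS i
    have tree : ∀ i, ∃ c Q, Tree p o (α i).seq c Q := by
      intro i
      have hrun := run_of_seq S α i fun j _ => ho j trivial
      rw [h0] at hrun
      obtain ⟨-, c, Q, -, -, hQ, -⟩ := hrun.node (ho i trivial)
      exact ⟨c, Q, hQ⟩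
    have inj : Function.Injective fun i => (α i).seq := by
      intro i j e
      rcases lt_trichotomy i j with hlt | rfl | hlt
      · exact absurd e ((seq_ne_of_lt h0 fun k _ => hS k).2 i hlt)
      · rfl
      · exact absurd e.symm ((seq_ne_of_lt h0 fun k _ => hS k).2 j hlt)
    have next : ∀ x : {x : List (Label × Config Msg) × Config Msg //
        Run (CStepFollowing p o) (p.initial Msg) x.1 x.2},
        ∃ y : {x : List (Label × Config Msg) × Config Msg //
          Run (CStepFollowing p o) (p.initial Msg) x.1 x.2}, ∃ α, CStep p x.1.2 α y.1.2 := by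
      rintro ⟨⟨l, T⟩, hl⟩
      -- The infinite abstract run has infinitely many distinct decorations, and `l` covers only
      -- finitely many; so every finite concrete run can be continued, and iteration gives an
      -- infinite one.
      obtain ⟨i, hi⟩ : ∃ i, (α i).seq ∉ done l := by
        by_contra! hall
        exact (Set.infinite_range_of_injective inj)
          ((List.finite_toSet (done l)).subset (Set.range_subset_iff.2 hall))
      obtain ⟨c, Q, hQ⟩ := tree i
      obtain ⟨β, T', hT'⟩ := hp.exists_next hl hQ hi
      exact ⟨⟨⟨_, T'⟩, hl.snoc hT'⟩, β, hT'.cStep⟩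
    choose f hf using next
    refine ⟨fun k => (f^[k] ⟨⟨[], p.initial Msg⟩, .nil⟩).1.2, rfl, fun k => ?_⟩
    dsimp only
    rw [Function.iterate_succ_apply']
    exact hf _
  · rintro ⟨S, h0, hS⟩
    refine ⟨fun i => Omega (S i), (congrArg Omega h0).trans (omega_initial p), fun i => ?_⟩
    obtain ⟨α, h⟩ := hS i
    exact ⟨α, h.omega⟩

/-! ### Finite computations -/

/-- The concrete run performs every decoration of the abstract one, possibly in another order and
among others; `I` matches equal decorations and is injective because the abstract ones are distinct.
-/
theorem Program.NonBlocking.simulate {p : Program} (hp : p.NonBlocking) (n : ℕ)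
    (α : Fin n → Label) (S : Fin (n + 1) → Config AMsg)
    (h : IsComputation (AStep p) (p.initial AMsg) n α S) :
    ∃ (m : ℕ) (α' : Fin m → Label) (S' : Fin (m + 1) → Config Msg) (I : Fin n → Fin m),
      IsComputation (CStep p) (p.initial Msg) m α' S' ∧ Function.Injective I ∧
      ∀ i : Fin n, LabelEquiv p (α i) (α' (I i)) ∧ ∃ P P' : Proc Value,
        IsProj (S i.succ) (α i) P ∧ IsProj (S' (I i).succ) (α' (I i)) P' ∧ ProcEquiv p P P' := by
  obtain ⟨h0, hS⟩ := h
  let T : ℕ → Config AMsg := fun i => if hi : i < n + 1 then S ⟨i, hi⟩ else S 0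
  let β : ℕ → Label := fun i => if hi : i < n then α ⟨i, hi⟩ else .silent []
  have hT : ∀ i : Fin (n + 1), T i = S i := fun i => dif_pos i.2
  have hβ : ∀ i : Fin n, β i = α i := fun i => dif_pos i.2
  have hT0 : T 0 = p.initial AMsg := (hT 0).trans h0
  have step : ∀ i, i < n → AStep p (T i) (β i) (T (i + 1)) := by
    intro i hi
    have := hS ⟨i, hi⟩
    rwa [← hβ, ← hT, ← hT] at this
  obtain ⟨o, ho⟩ := exists_oracle (J := (· < n)) (fun i j hij hj => lt_of_le_of_lt hij hj) hT0 step
  have run : ∀ i ≤ n, Run (AStepFollowing p o) (p.initial AMsg)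
      ((List.range i).map fun j => (β j, T (j + 1))) (T i) := by
    intro i hi
    have := run_of_seq T β i fun j hj => ho j (lt_of_lt_of_le hj hi)
    rwa [hT0] at this
  have distinct : ∀ j < n, (β j).seq ≠ [0] ∧ ∀ i < j, (β i).seq ≠ (β j).seq :=
    fun j hj => seq_ne_of_lt hT0 fun k hk => step k (lt_of_le_of_lt hk hj)
  obtain ⟨l, S', hl, hd⟩ := hp.run_all (o := o) ((List.range n).map fun i => (β i).seq) (by
    intro σ hσ
    obtain ⟨i, hi, rfl⟩ := List.mem_map.1 hσ
    rw [List.mem_range] at hi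
    obtain ⟨-, c, Q, -, -, hQ, -⟩ := (run i hi.le).node (ho i hi)
    exact ⟨c, Q, hQ⟩)
  have index : ∀ i : Fin n, ∃ j : Fin l.length, l[j].1.seq = (β i).seq := by
    intro i
    have hmem := hd (List.mem_map_of_mem (f := fun i => (β i).seq) (List.mem_range.2 i.2))
    rcases List.mem_cons.1 hmem with h | h
    -- The list `done` also contains the initial decoration `[0]`, which labels no transition.
    · exact absurd h (distinct i i.2).1
    · obtain ⟨e, he, hσ⟩ := List.mem_map.1 h
      obtain ⟨j, hj, rfl⟩ := List.getElem_of_mem he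
      exact ⟨⟨j, hj⟩, hσ⟩
  choose I hI using index
  obtain ⟨U, hU0, -, hU⟩ := hl.exists_seq
  refine ⟨l.length, fun j => l[j].1, fun j => U j, I, ⟨hU0, fun j => ?_⟩, ?_, fun i => ?_⟩
  · exact (hU j j.2).2.1.cStep
  · intro i j e
    have e' : (β i).seq = (β j).seq := by rw [← hI i, ← hI j, e]
    rcases lt_trichotomy i j with hlt | rfl | hlt
    · exact absurd e' ((distinct j j.2).2 i hlt)
    · rfl
    · exact absurd e'.symm ((distinct i i.2).2 j hlt)
  · obtain ⟨h1, h2, -⟩ := hU (I i) (I i).2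
    have := (run i i.2.le).compare (ho i i.2) h1 h2 (hI i).symm
    rw [hβ] at this
    have hsucc : T (i + 1) = S i.succ := hT i.succ
    rw [hsucc] at this
    exact this

end ActorSL

open ActorSL
theorem mainTheorem8 (p : Program) :
    (∀ (S S' : Config Msg) (α : Label), CStep p S α S' → AStep p (Omega S) α (Omega S')) ∧
    (p.NonBlocking →
      (∀ (n : ℕ) (α : Fin n → Label) (S : Fin (n + 1) → Config AMsg),
        IsComputation (AStep p) (p.initial AMsg) n α S →
        ∃ (m : ℕ) (α' : Fin m → Label) (S' : Fin (m + 1) → Config Msg) (I : Fin n → Fin m),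
          IsComputation (CStep p) (p.initial Msg) m α' S' ∧
          Function.Injective I ∧
          ∀ i : Fin n,
            LabelEquiv p (α i) (α' (I i)) ∧
            ∃ P P' : Proc Value,
              IsProj (S i.succ) (α i) P ∧
              IsProj (S' (I i).succ) (α' (I i)) P' ∧
              ProcEquiv p P P') ∧
      (HasInfiniteComputation (AStep p) (p.initial AMsg) ↔
        HasInfiniteComputation (CStep p) (p.initial Msg)) ∧
      (∀ (C : ClassName) (Q : Proc Value),
        ReachesControl p (AStep p) (p.initial AMsg) C Q ↔
          ReachesControl p (CStep p) (p.initial Msg) C Q)) :=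
  ⟨fun _ _ _ h => h.omega, fun hp => ⟨hp.simulate, hp.hasInfiniteComputation_iff,
    hp.reachesControl_iff⟩⟩
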